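/- Let $G$ be a finite simple connected non-bipartite $d$-regular graph with $d\ge 3$, on $n$ vertices and with $m$ edges, let $A$ be its adjacency matrix with eigenvalues $\lambda_1\ge\lambda_2\ge\dots\ge\lambda_n$, and let $\lambda=\max_{i\ge 2}|\lambda_i|$. Let $P(u,v)=1/d_u$ if $u\sim v$ and $0$ otherwise be the transition matrix of the simple random walk, and $\pi(v)=d_v/\sum_w d_w$ (here $\pi = 1/n$). Let $\tilde P$ be the transition matrix of the non-backtracking random walk on the $2m$ directed edges, $\tilde P((u,v),(x,y))=1/(d_v-1)$ if $x=v$ and $y\ne u$, and $0$ otherwise, and let $\tilde\pi=1/(2m)$ be the uniform distribution on directed edges. Let $P^{(k)}(u,v)$ be the probability that a non-backtracking random walk started at the vertex $u$ (with uniformly chosen first step) is at the vertex $v$ after $k$ steps. Let $\rho$ and $\tilde\rho$ be the mixing rates of the simple and of the non-backtracking random walk on $G$. The statement holds for each of the following two ways of measuring them: (a) pointwise, on the vertices: $\rho=\limsup_{t\to\infty}\max_{u,v}|P^t(u,v)-\pi(v)|^{1/t}$ and $\tilde\rho=\limsup_{t\to\infty}\max_{u,v}|P^{(t)}(u,v)-\pi(v)|^{1/t}$;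 (b) in $\chi$-squared distance, with the non-backtracking walk as a Markov chain on directed edges: $\rho=\limsup_{t\to\infty}\Delta(P^t,\pi)^{1/t}$ and $\tilde\rho=\limsup_{t\to\infty}\Delta(\tilde P^t,\tilde\pi)^{1/t}$, where $\Delta(M,p)=\max_x\bigl(\sum_y (M(x,y)-p(y))^2/p(y)\bigr)^{1/2}$. 1. If $\lambda\ge 2\sqrt{d-1}$, then $$\frac{d}{2(d-1)}\le\frac{\tilde\rho}{\rho}\le 1.$$ 2. If $\lambda<2\sqrt{d-1}$ and $d=n^{o(1)}$, then $$\frac{\tilde\rho}{\rho}=\frac{d}{2(d-1)}+o(1)\qquad(n\to\infty).$$ That is, for every sequence of graphs $G_i$ as above, with $n_i\to\infty$ vertices and degrees $d_i=n_i^{\varepsilon_i}\ge 3$ where $\varepsilon_i\to 0$, all with $\lambda(G_i)<2\sqrt{d_i-1}$, one has $\tilde\rho(G_i)/\rho(G_i)-\frac{d_i}{2(d_i-1)}\to 0$. -/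

import Mathlib

open Filter Topology

noncomputable section

namespace NBWalk

/-! ### Rates of convergence of a sequence of transition matrices -/

section Rates

variable {α : Type*} [Fintype α]

/-- The rate `limsup_t (max_{x,y} |M_t(x,y) - p(y)|)^{1/t}` at which the `t`-step transition
matrices `M t` approach the distribution `p`, in the pointwise distance. -/
def pointwiseRate (M : ℕ → Matrix α α ℝ) (p : α → ℝ) : ℝ :=
  limsup (fun t : ℕ => (⨆ x : α, ⨆ y : α, |M t x y - p y|) ^ (1 / (t : ℝ))) atTop

/-- The chi-squared distance
`max_x (∑_y (M(x,y) - p(y))² / p(y))^{1/2}` between a transition matrix and a distribution. -/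
def chiSqDist (M : Matrix α α ℝ) (p : α → ℝ) : ℝ :=
  ⨆ x : α, Real.sqrt (∑ y : α, (M x y - p y) ^ 2 / p y)

/-- The rate `limsup_t Δ(t)^{1/t}`, where `Δ(t)` is the chi-squared distance of the `t`-step
transition matrix `M t` from `p`. -/
def chiSqRate (M : ℕ → Matrix α α ℝ) (p : α → ℝ) : ℝ :=
  limsup (fun t : ℕ => chiSqDist (M t) p ^ (1 / (t : ℝ))) atTop

end Rates

/-! ### Simple and non-backtracking random walk on a graph -/

section Walks

variable {V : Type*} [Fintype V] [DecidableEq V] (G : SimpleGraph V) [DecidableRel G.Adj]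

/-- The volume `∑_v d_v`, which is twice the number of edges. -/
def vol : ℝ := ∑ v : V, (G.degree v : ℝ)

/-- The transition matrix of the simple random walk. -/
def transition : Matrix V V ℝ :=
  fun u v => if G.Adj u v then 1 / (G.degree u : ℝ) else 0

/-- The stationary distribution `v ↦ d_v / vol G` on the vertices. -/
def stationary : V → ℝ := fun v => (G.degree v : ℝ) / vol G

/-- The transition matrix of the non-backtracking walk on directed edges: from `(u,v)` the walk
moves to each `(v,y)` with `y ≠ u` with probability `1 / (d_v - 1)`. -/
def nbTransition : Matrix G.Dart G.Dart ℝ :=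
  fun e f => if e.snd = f.fst ∧ f.snd ≠ e.fst then 1 / ((G.degree e.snd : ℝ) - 1) else 0

/-- The uniform distribution on the directed edges. -/
def nbStationary : G.Dart → ℝ := fun _ => 1 / vol G

/-- The probability that a non-backtracking walk started at the vertex `u` is at the vertex `v`
after `k` steps. The first edge is chosen uniformly among the `d_u` directed edges leaving `u`,
and the position after `k` steps is the tail of the `(k+1)`-st directed edge. -/
def nbVertexTransition (k : ℕ) : Matrix V V ℝ :=
  fun u v => ∑ e : G.Dart, ∑ f : G.Dart,
    if e.fst = u ∧ f.fst = v then 1 / (G.degree u : ℝ) * (nbTransition G ^ k) e f else 0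

/-- The mixing rate of the simple random walk. -/
def mixingRate : ℝ :=
  pointwiseRate (fun t => transition G ^ t) (stationary G)

/-- The mixing rate of the non-backtracking random walk, as a walk on the vertices. -/
def nbMixingRate : ℝ :=
  pointwiseRate (fun t => nbVertexTransition G t) (stationary G)

/-- The mixing rate of the simple random walk in the chi-squared distance. -/
def chiMixingRate : ℝ :=
  chiSqRate (fun t => transition G ^ t) (stationary G)

/-- The mixing rate of the non-backtracking random walk in the chi-squared distance, as a Markov
chain on the directed edges. -/
def nbChiMixingRate : ℝ :=
  chiSqRate (fun t => nbTransition G ^ t) (nbStationary G)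

/-- The second largest adjacency eigenvalue in absolute value, `max_{i ≥ 2} |λ_i|`, where
`λ_1 ≥ λ_2 ≥ … ≥ λ_n` are the adjacency eigenvalues with multiplicity. (Mathlib's
`eigenvalues₀` lists them in decreasing order, starting with the index `0`.) -/
def secondEigenvalue : ℝ :=
  ⨆ i : {i : Fin (Fintype.card V) // 0 < i.val},
    |(G.isHermitian_adjMatrix ℝ).eigenvalues₀ i.val|

end Walks

end NBWalk

end

noncomputable section

namespace NBWalk

set_option linter.unusedSectionVars false

/-! ### Exponential rates -/

/-! Put `q = d - 1` and let `λ` be the second eigenvalue. All four rates are explicit: the two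
simple ones are `λ / d`, the two non-backtracking ones `nbRoot q λ / q` (`mixingRate_eq`,
`nbMixingRate_eq`). The theorem is then about a function of `q` and `λ`.

Upper bounds: Gelfand's formula applied to the transition matrix minus its limit reduces them to
nontrivial complex eigenvalues. An eigenvalue `y ≠ 0` of the non-backtracking matrix satisfies `y ^
2 = 1` or `y + q / y = μ` with `μ` an adjacency eigenvalue (`nbMat_eigenvector`), so `|y|` is at
most `nbRoot q λ`. Lower bounds: on an adjacency eigenvector with `|μ| = λ` the vertex walk acts by
a scalar obeying a second-order recursion whose larger root has modulus `nbRoot q λ`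
(`frequently_le_abs_nbCountEig`).

If `λ ≥ 2√q`, the ratio is `d / (2q) * (1 + √(1 - 4q/λ²))`, and `λ ≤ d` gives the bound `1`. If `λ <
2√q`, it is `d / (2q) * 2√q / λ`, so `λ ≥ (2 - o(1)) √q` is needed. This is the Alon–Boppana bound
(`alonBoppana`), proved with a test vector around a single vertex. Its error is a power of `d`
divided by `n`, negligible when `d = n^{o(1)}`. -/

theorem tendsto_mul_const_rpow_one_div {c r : ℝ} (hc : 0 < c) :
    Tendsto (fun t : ℕ => c ^ (1 / (t : ℝ)) * r) atTop (𝓝 r) := by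
  have h : Tendsto (fun t : ℕ => c ^ (1 / (t : ℝ))) atTop (𝓝 (c ^ (0 : ℝ))) :=
    ((Real.continuous_const_rpow hc.ne').tendsto 0).comp tendsto_one_div_atTop_nhds_zero_nat
  simpa using h.mul_const r

theorem mul_pow_rpow_one_div {c r : ℝ} (hc : 0 ≤ c) (hr : 0 ≤ r) {t : ℕ} (ht : t ≠ 0) :
    (c * r ^ t) ^ (1 / (t : ℝ)) = c ^ (1 / (t : ℝ)) * r := by
  rw [Real.mul_rpow hc (by positivity), one_div, Real.pow_rpow_inv_natCast hr ht]

/-- A nonnegative sequence of exponential order `r` from above and, along a subsequence, from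
below has `limsup a_t^{1/t} = r`. -/
theorem limsup_rpow_one_div_eq {a : ℕ → ℝ} {r : ℝ} (ha : ∀ t, 0 ≤ a t) (hr : 0 < r)
    (hup : ∀ s > r, ∃ C : ℝ, 0 < C ∧ ∀ᶠ t in atTop, a t ≤ C * s ^ t)
    (hlo : ∃ c : ℝ, 0 < c ∧ ∃ᶠ t in atTop, c * r ^ t ≤ a t) :
    limsup (fun t : ℕ => a t ^ (1 / (t : ℝ))) atTop = r := by
  have key : ∀ s > r, ∀ᶠ t : ℕ in atTop, a t ^ (1 / (t : ℝ)) ≤ s := by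
    intro s hs
    -- The room between `s'` and `s` absorbs the constant, since `C ^ (1/t) * s'` tends to `s'`.
    obtain ⟨s', hs', hs's⟩ := exists_between hs
    obtain ⟨C, hC, h⟩ := hup s' hs'
    have h1 := (tendsto_mul_const_rpow_one_div (r := s') hC).eventually_le_const hs's
    filter_upwards [h, h1, eventually_ne_atTop 0] with t h2 h3 h4
    refine le_trans (Real.rpow_le_rpow (ha t) h2 (by positivity)) ?_
    rwa [mul_pow_rpow_one_div hC.le (hr.trans hs').le h4]
  have hnn : ∀ t : ℕ, 0 ≤ a t ^ (1 / (t : ℝ)) := fun t => Real.rpow_nonneg (ha t) _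
  have hcob : IsCoboundedUnder (· ≤ ·) atTop (fun t : ℕ => a t ^ (1 / (t : ℝ))) :=
    (isBoundedUnder_of ⟨0, hnn⟩ :
      IsBoundedUnder (· ≥ ·) atTop (fun t : ℕ => a t ^ (1 / (t : ℝ)))).isCoboundedUnder_le
  have hbdd : IsBoundedUnder (· ≤ ·) atTop (fun t : ℕ => a t ^ (1 / (t : ℝ))) :=
    ⟨r + 1, by simpa using key (r + 1) (by linarith)⟩
  apply le_antisymm
  · refine le_of_forall_gt_imp_ge_of_dense fun s hs => ?_
    exact limsup_le_of_le hcob (key s hs)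
  · refine le_of_forall_lt_imp_le_of_dense fun s hs => ?_
    obtain ⟨c, hc, h⟩ := hlo
    have h1 := (tendsto_mul_const_rpow_one_div (r := r) hc).eventually_const_le hs
    refine le_limsup_of_frequently_le ?_ hbdd
    refine (h.and_eventually (h1.and (eventually_ne_atTop 0))).mono ?_
    rintro t ⟨h2, h3, h4⟩
    refine h3.trans ?_
    rw [← mul_pow_rpow_one_div hc.le hr.le h4]
    exact Real.rpow_le_rpow (by positivity) h2 (by positivity)

section Rates

variable {α : Type*} [Fintype α]

theorem abs_le_iSup_iSup (D : α → α → ℝ) (x y : α) :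
    |D x y| ≤ ⨆ x : α, ⨆ y : α, |D x y| :=
  (le_ciSup (f := fun y => |D x y|) (Set.finite_range _).bddAbove y).trans
    (le_ciSup (f := fun x => ⨆ y, |D x y|) (Set.finite_range _).bddAbove x)

theorem pointwiseRate_eq [Nonempty α] {M : ℕ → Matrix α α ℝ} {p : α → ℝ} {r : ℝ} (hr : 0 < r)
    (hup : ∀ s > r, ∃ C : ℝ, 0 < C ∧ ∀ᶠ t in atTop, ∀ x y, |M t x y - p y| ≤ C * s ^ t)
    (hlo : ∃ c : ℝ, 0 < c ∧ ∃ᶠ t in atTop, ∃ x y, c * r ^ t ≤ |M t x y - p y|) :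
    pointwiseRate M p = r := by
  refine limsup_rpow_one_div_eq ?_ hr ?_ ?_
  · intro t
    exact Real.iSup_nonneg fun x => Real.iSup_nonneg fun y => abs_nonneg _
  · intro s hs
    obtain ⟨C, hC, h⟩ := hup s hs
    refine ⟨C, hC, h.mono fun t ht => ciSup_le fun x => ciSup_le fun y => ht x y⟩
  · obtain ⟨c, hc, h⟩ := hlo
    refine ⟨c, hc, h.mono ?_⟩
    rintro t ⟨x, y, hxy⟩
    exact hxy.trans (abs_le_iSup_iSup (fun x y => M t x y - p y) x y)

/-- For uniform `p` the chi-squared distance lies between the largest entry of the error and `|α|`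
times it, so the entrywise hypotheses of `pointwiseRate_eq` determine this rate too. -/
theorem chiSqRate_eq [Nonempty α] {M : ℕ → Matrix α α ℝ} {p : α → ℝ} {r : ℝ} (hr : 0 < r)
    (hp : ∀ y, p y = 1 / (Fintype.card α : ℝ))
    (hup : ∀ s > r, ∃ C : ℝ, 0 < C ∧ ∀ᶠ t in atTop, ∀ x y, |M t x y - p y| ≤ C * s ^ t)
    (hlo : ∃ c : ℝ, 0 < c ∧ ∃ᶠ t in atTop, ∃ x y, c * r ^ t ≤ |M t x y - p y|) :
    chiSqRate M p = r := by
  have hN : (1 : ℝ) ≤ Fintype.card α := by exact_mod_cast Fintype.card_pos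
  refine limsup_rpow_one_div_eq ?_ hr ?_ ?_
  · intro t
    exact Real.iSup_nonneg fun x => Real.sqrt_nonneg _
  · intro s hs
    obtain ⟨C, hC, h⟩ := hup s hs
    refine ⟨Fintype.card α * C, by positivity, h.mono fun t ht => ciSup_le fun x => ?_⟩
    have hs0 : 0 < s := hr.trans hs
    refine Real.sqrt_le_iff.2 ⟨by positivity, ?_⟩
    have : ∀ y ∈ Finset.univ, (M t x y - p y) ^ 2 / p y ≤
        Fintype.card α * (C * s ^ t) ^ 2 := by
      intro y _
      rw [hp y, div_div_eq_mul_div, div_one, mul_comm, ← sq_abs, ← hp y]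
      gcongr
      exact ht x y
    refine (Finset.sum_le_card_nsmul _ _ _ this).trans_eq ?_
    rw [nsmul_eq_mul, Finset.card_univ]
    ring
  · obtain ⟨c, hc, h⟩ := hlo
    refine ⟨c, hc, h.mono ?_⟩
    rintro t ⟨x, y, hxy⟩
    refine hxy.trans ?_
    refine le_trans ?_ (le_ciSup (f := fun x => Real.sqrt (∑ y, (M t x y - p y) ^ 2 / p y))
      (Set.finite_range _).bddAbove x)
    refine Real.le_sqrt_of_sq_le ?_
    have hnn : ∀ z ∈ Finset.univ, 0 ≤ (M t x z - p z) ^ 2 / p z := fun z _ => by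
      rw [hp z]; positivity
    refine le_trans ?_ (Finset.single_le_sum hnn (Finset.mem_univ y))
    rw [sq_abs, hp y, div_div_eq_mul_div, div_one]
    exact le_mul_of_one_le_right (sq_nonneg _) hN

end Rates

/-! ### Doubly stochastic matrices -/

section Stochastic

variable {α : Type*} [Fintype α]

/-- The matrix all of whose entries are `1 / |α|`. -/
def avg (α : Type*) [Fintype α] (K : Type*) [Field K] : Matrix α α K :=
  fun _ _ => 1 / (Fintype.card α : K)

variable {K : Type*} [Field K] {M : Matrix α α K}

theorem mul_avg (hrow : ∀ x, ∑ y, M x y = 1) : M * avg α K = avg α K := by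
  ext x y
  simp only [Matrix.mul_apply, avg]
  rw [← Finset.sum_mul, hrow, one_mul]

theorem avg_mul (hcol : ∀ y, ∑ x, M x y = 1) : avg α K * M = avg α K := by
  ext x y
  simp only [Matrix.mul_apply, avg]
  rw [← Finset.mul_sum, hcol, mul_one]

/-- The averaging matrix is an idempotent absorbing `M` on both sides, so all mixed terms collapse.
The exponent is `t + 1` because the zeroth power of the left side is the identity. -/
theorem sub_avg_pow [DecidableEq α] [CharZero K] [Nonempty α] (hrow : ∀ x, ∑ y, M x y = 1)
    (hcol : ∀ y, ∑ x, M x y = 1) (t : ℕ) :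
    (M - avg α K) ^ (t + 1) = M ^ (t + 1) - avg α K := by
  have hN : (Fintype.card α : K) ≠ 0 := by exact_mod_cast Fintype.card_ne_zero
  have hJ : avg α K * avg α K = avg α K :=
    mul_avg fun x => by simp [avg, hN]
  have hMJ : ∀ t : ℕ, M ^ t * avg α K = avg α K := by
    intro t
    induction t with
    | zero => simp
    | succ t ih => rw [pow_succ, mul_assoc, mul_avg hrow, ih]
  induction t with
  | zero => simp
  | succ t ih =>
    rw [pow_succ, ih, mul_sub, sub_mul, sub_mul, ← pow_succ, avg_mul hcol, hMJ, hJ]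
    abel

theorem avg_mulVec_eq_zero {f : α → K} (hf : ∑ x, f x = 0) : (avg α K).mulVec f = 0 := by
  ext x
  simp only [Matrix.mulVec, dotProduct, avg, ← Finset.mul_sum, hf, mul_zero, Pi.zero_apply]

section

-- Gelfand's formula needs a submultiplicative norm; the row-sum norm also dominates every entry.
attribute [local instance] Matrix.linftyOpNormedAddCommGroup Matrix.linftyOpNormedRing
  Matrix.linftyOpNormedAlgebra Matrix.linftyOpNormedSpace

theorem norm_entry_le_linftyOp (N : Matrix α α ℂ) (x y : α) : ‖N x y‖ ≤ ‖N‖ := by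
  rw [Matrix.linfty_opNorm_def, ← coe_nnnorm, NNReal.coe_le_coe]
  exact (Finset.single_le_sum (f := fun j => ‖N x j‖₊) (fun _ _ => zero_le)
    (Finset.mem_univ y)).trans
    (Finset.le_sup (f := fun i => ∑ j, ‖N i j‖₊) (Finset.mem_univ x))

/-- Powers of a complex matrix grow at most at the rate of its largest eigenvalue. -/
theorem eventually_norm_pow_entry_le [DecidableEq α] [Nonempty α] {N : Matrix α α ℂ} {r s : ℝ} (hr : 0 ≤ r)
    (hN : ∀ (z : ℂ) (f : α → ℂ), f ≠ 0 → N.mulVec f = z • f → ‖z‖ ≤ r) (hs : r < s) :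
    ∀ᶠ t : ℕ in atTop, ∀ x y, ‖(N ^ t) x y‖ ≤ s ^ t := by
  have hrad : spectralRadius ℂ N ≤ ENNReal.ofReal r := by
    refine iSup₂_le fun z hz => ?_
    rw [← Matrix.spectrum_toLin', ← Module.End.hasEigenvalue_iff_mem_spectrum] at hz
    obtain ⟨f, hf⟩ := hz.exists_hasEigenvector
    have := hN z f hf.2 (by simpa using hf.apply_eq_smul)
    rw [← enorm_eq_nnnorm, ← ofReal_norm]
    exact ENNReal.ofReal_le_ofReal this
  have : CompleteSpace (Matrix α α ℂ) := FiniteDimensional.complete ℂ _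
  have hlim := spectrum.pow_norm_pow_one_div_tendsto_nhds_spectralRadius N
  have hlt : spectralRadius ℂ N < ENNReal.ofReal s :=
    hrad.trans_lt ((ENNReal.ofReal_lt_ofReal_iff (hr.trans_lt hs)).2 hs)
  filter_upwards [hlim.eventually_lt_const hlt, eventually_ne_atTop 0] with t ht ht0 x y
  refine (norm_entry_le_linftyOp _ x y).trans ?_
  rw [ENNReal.ofReal_lt_ofReal_iff (hr.trans_lt hs)] at ht
  calc ‖N ^ t‖ = (‖N ^ t‖ ^ (1 / (t : ℝ))) ^ t := by
        rw [one_div, Real.rpow_inv_natCast_pow (norm_nonneg _) ht0]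
    _ ≤ s ^ t := by
        have : 0 ≤ ‖N ^ t‖ ^ (1 / (t : ℝ)) := Real.rpow_nonneg (norm_nonneg _) _
        gcongr

end

/-- Convergence rate of a doubly stochastic matrix from its nontrivial complex eigenvalues. -/
theorem eventually_abs_pow_sub_le [DecidableEq α] [Nonempty α] {M : Matrix α α ℝ} {r s : ℝ} (hr : 0 ≤ r)
    (hrow : ∀ x, ∑ y, M x y = 1) (hcol : ∀ y, ∑ x, M x y = 1)
    (hM : ∀ (z : ℂ) (f : α → ℂ), z ≠ 0 → f ≠ 0 → ∑ x, f x = 0 →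
      (M.map Complex.ofReal).mulVec f = z • f → ‖z‖ ≤ r) (hs : r < s) :
    ∀ᶠ t : ℕ in atTop, ∀ x y, |(M ^ t) x y - 1 / (Fintype.card α : ℝ)| ≤ s ^ t := by
  have hN : (Fintype.card α : ℂ) ≠ 0 := by exact_mod_cast Fintype.card_ne_zero
  have hrow' : ∀ x, ∑ y, (M.map Complex.ofReal) x y = 1 := fun x => by
    simp only [Matrix.map_apply]; exact_mod_cast congrArg Complex.ofReal (hrow x)
  have hcol' : ∀ y, ∑ x, (M.map Complex.ofReal) x y = 1 := fun y => by
    simp only [Matrix.map_apply]; exact_mod_cast congrArg Complex.ofReal (hcol y)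
  have hspec : ∀ (z : ℂ) (f : α → ℂ), f ≠ 0 →
      (M.map Complex.ofReal - avg α ℂ).mulVec f = z • f → ‖z‖ ≤ r := by
    intro z f hf hz
    rcases eq_or_ne z 0 with rfl | hz0
    · simpa using hr
    -- The columns of the difference sum to zero, so summing the eigenvalue equation gives `z * ∑ f
    -- = 0`. Hence `f` is already an eigenvector of `M`.
    have hsum : ∑ x, f x = 0 := by
      have h1 : ∑ x, ((M.map Complex.ofReal - avg α ℂ).mulVec f) x = 0 := by
        simp only [Matrix.mulVec, dotProduct]
        rw [Finset.sum_comm]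
        refine Finset.sum_eq_zero fun y _ => ?_
        rw [← Finset.sum_mul]
        simp only [Matrix.sub_apply, Finset.sum_sub_distrib, hcol']
        simp [avg, hN]
      rw [hz] at h1
      simp only [Pi.smul_apply, smul_eq_mul, ← Finset.mul_sum] at h1
      exact (mul_eq_zero.1 h1).resolve_left hz0
    rw [Matrix.sub_mulVec, avg_mulVec_eq_zero hsum, sub_zero] at hz
    exact hM z f hz0 hf hsum hz
  filter_upwards [eventually_norm_pow_entry_le hr hspec hs, eventually_ne_atTop 0] with t ht ht0 x y
  obtain ⟨k, rfl⟩ := Nat.exists_eq_succ_of_ne_zero ht0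
  have h2 := ht x y
  rw [Nat.succ_eq_add_one, sub_avg_pow hrow' hcol'] at h2
  have h3 : (M.map Complex.ofReal) ^ (k + 1) = (M ^ (k + 1)).map Complex.ofReal :=
    (Matrix.map_pow M Complex.ofRealHom (k + 1)).symm
  rw [h3, Matrix.sub_apply, Matrix.map_apply, avg] at h2
  have h4 : ((M ^ (k + 1)) x y : ℂ) - 1 / (Fintype.card α : ℂ) =
      (((M ^ (k + 1)) x y - 1 / (Fintype.card α : ℝ) : ℝ) : ℂ) := by push_cast; rfl
  rwa [h4, Complex.norm_real, Real.norm_eq_abs] at h2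

/-- A matrix with an eigenvalue `s` has an entry of modulus at least `|s| / |α|`. -/
theorem exists_abs_entry_ge_of_mulVec_eq {D : Matrix α α ℝ} {v : α → ℝ} {s : ℝ} (hv : v ≠ 0)
    (h : D.mulVec v = s • v) : ∃ x y, |s| / Fintype.card α ≤ |D x y| := by
  obtain ⟨x0, hx0⟩ := Function.ne_iff.1 hv
  have : Nonempty α := ⟨x0⟩
  -- In the row where `|v|` is largest, entries all below `|s| / |α|` could not produce `s * v x`.
  obtain ⟨x, hx⟩ := Finite.exists_max fun x => |v x|
  have hvx : 0 < |v x| := (abs_pos.2 hx0).trans_le (hx x0)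
  have hN : (0 : ℝ) < Fintype.card α := by exact_mod_cast Fintype.card_pos
  refine ⟨x, ?_⟩
  by_contra! hlt
  have h1 : |s| * |v x| ≤ ∑ y, |D x y| * |v x| := by
    have h2 := congrFun h x
    simp only [Matrix.mulVec, dotProduct, Pi.smul_apply, smul_eq_mul] at h2
    rw [← abs_mul, ← h2]
    refine (Finset.abs_sum_le_sum_abs _ _).trans (Finset.sum_le_sum fun y _ => ?_)
    rw [abs_mul]
    exact mul_le_mul_of_nonneg_left (hx y) (abs_nonneg _)
  have h3 : ∑ y, |D x y| * |v x| < ∑ _y : α, |s| / Fintype.card α * |v x| :=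
    Finset.sum_lt_sum_of_nonempty Finset.univ_nonempty fun y _ =>
      mul_lt_mul_of_pos_right (hlt y) hvx
  rw [Finset.sum_const, Finset.card_univ, nsmul_eq_mul] at h3
  have h4 : (Fintype.card α : ℝ) * (|s| / Fintype.card α * |v x|) = |s| * |v x| := by
    field_simp
  linarith

end Stochastic

/-! ### Incidence matrices between vertices and darts -/

section Incidence

variable {V : Type*} [Fintype V] [DecidableEq V] (G : SimpleGraph V) [DecidableRel G.Adj]
variable (K : Type*) [Field K]

/-- The incidence matrix of vertices and the darts starting there. -/
def startMat : Matrix V G.Dart K := fun v e => if e.fst = v then 1 else 0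

/-- The incidence matrix of vertices and the darts ending there. -/
def endMat : Matrix V G.Dart K := fun v e => if e.snd = v then 1 else 0

/-- The permutation matrix of dart reversal. -/
def revMat : Matrix G.Dart G.Dart K := fun e f => if f = e.symm then 1 else 0

/-- The non-backtracking (Hashimoto) matrix. -/
def nbMat : Matrix G.Dart G.Dart K :=
  fun e f => if e.snd = f.fst ∧ f.snd ≠ e.fst then 1 else 0

variable {G K} in
theorem sum_dart (F : V → V → K) :
    ∑ e : G.Dart, F e.fst e.snd = ∑ u, ∑ v, if G.Adj u v then F u v else 0 := by
  rw [← Fintype.sum_prod_type' (f := fun u v => if G.Adj u v then F u v else 0),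
    ← Finset.sum_filter]
  refine Finset.sum_bij (fun e _ => e.toProd) ?_ ?_ ?_ ?_
  · intro e _; simp
  · intro e _ f _ h; exact SimpleGraph.Dart.ext _ _ h
  · intro p hp; exact ⟨⟨p, by simpa using hp⟩, Finset.mem_univ _, rfl⟩
  · intro e _; rfl

variable {G} {d : ℕ}

theorem sum_adj_eq (hd : G.IsRegularOfDegree d) (u : V) :
    (∑ v, if G.Adj u v then (1 : K) else 0) = d := by
  rw [← hd u, ← SimpleGraph.card_neighborFinset_eq_degree, SimpleGraph.neighborFinset_eq_filter,
    Finset.sum_boole]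

theorem startMat_mul_transpose (hd : G.IsRegularOfDegree d) :
    startMat G K * (startMat G K).transpose = (d : K) • (1 : Matrix V V K) := by
  ext u v
  simp only [Matrix.mul_apply, Matrix.transpose_apply, startMat, Matrix.smul_apply,
    Matrix.one_apply, smul_eq_mul]
  rw [sum_dart (fun a _ => (if a = u then (1 : K) else 0) * (if a = v then 1 else 0)),
    Finset.sum_eq_single u]
  · by_cases h : u = v
    · simp only [h, if_true, mul_one]; exact sum_adj_eq K hd v
    · simp [h]
  · intro a _ ha; simp [ha]
  · simp

theorem endMat_mul_transpose (hd : G.IsRegularOfDegree d) :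
    endMat G K * (endMat G K).transpose = (d : K) • (1 : Matrix V V K) := by
  ext u v
  simp only [Matrix.mul_apply, Matrix.transpose_apply, endMat, Matrix.smul_apply,
    Matrix.one_apply, smul_eq_mul]
  rw [sum_dart (fun _ a => (if a = u then (1 : K) else 0) * (if a = v then 1 else 0)),
    Finset.sum_comm, Finset.sum_eq_single u]
  · by_cases h : u = v
    · simp only [h, if_true, mul_one, G.adj_comm _ v]; exact sum_adj_eq K hd v
    · simp [h]
  · intro a _ ha; simp [ha]
  · simp

theorem startMat_mul_endMat_transpose :
    startMat G K * (endMat G K).transpose = G.adjMatrix K := by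
  ext u v
  simp only [Matrix.mul_apply, Matrix.transpose_apply, startMat, endMat, SimpleGraph.adjMatrix_apply]
  rw [sum_dart (fun a b => (if a = u then (1 : K) else 0) * (if b = v then 1 else 0)),
    Finset.sum_eq_single u, Finset.sum_eq_single v]
  · simp
  · intro a _ ha; simp [ha]
  · simp
  · intro a _ ha; simp [ha]
  · simp

theorem eq_symm_iff (e f : G.Dart) : f = e.symm ↔ e = f.symm := by
  constructor <;> rintro rfl <;> simp

theorem startMat_mul_revMat : startMat G K * revMat G K = endMat G K := by
  ext v f
  simp [Matrix.mul_apply, startMat, revMat, endMat, eq_symm_iff _ f]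

theorem endMat_mul_revMat : endMat G K * revMat G K = startMat G K := by
  ext v f
  simp [Matrix.mul_apply, startMat, revMat, endMat, eq_symm_iff _ f]

theorem revMat_mul_revMat : revMat G K * revMat G K = 1 := by
  ext e f
  rw [Matrix.mul_apply, Finset.sum_eq_single e.symm]
  · simp [revMat, Matrix.one_apply, eq_comm]
  · intro g _ hg; simp [revMat, hg]
  · simp

theorem nbMat_eq : nbMat G K = (endMat G K).transpose * startMat G K - revMat G K := by
  ext e f
  have h1 : ((endMat G K).transpose * startMat G K) e f = if e.snd = f.fst then 1 else 0 := by
    simp [Matrix.mul_apply, endMat, startMat, eq_comm]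
  rw [Matrix.sub_apply, h1]
  have h2 : f = e.symm ↔ e.snd = f.fst ∧ f.snd = e.fst := by
    rw [SimpleGraph.Dart.ext_iff, Prod.ext_iff]
    simp [eq_comm]
  simp only [nbMat, revMat, h2]
  by_cases h3 : e.snd = f.fst <;> by_cases h4 : f.snd = e.fst <;> simp [h3, h4]

/-- With `endMat_mul_nbMat` this is a closed linear system for the two incidence matrices.
Eliminating `endMat` gives both the recursion of `nbCount` and the equation `y + (d-1)/y = μ`. -/
theorem startMat_mul_nbMat :
    startMat G K * nbMat G K = G.adjMatrix K * startMat G K - endMat G K := by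
  rw [nbMat_eq, Matrix.mul_sub, ← Matrix.mul_assoc, startMat_mul_endMat_transpose, startMat_mul_revMat]

theorem endMat_mul_nbMat (hd : G.IsRegularOfDegree d) :
    endMat G K * nbMat G K = ((d : K) - 1) • startMat G K := by
  rw [nbMat_eq, Matrix.mul_sub, ← Matrix.mul_assoc, endMat_mul_transpose K hd, endMat_mul_revMat,
    Matrix.smul_mul, Matrix.one_mul, sub_smul, one_smul]

/-- In a `d`-regular graph, `d (d-1)^k` times the `k`-step non-backtracking transition matrix on
the vertices. -/
def nbCount (G : SimpleGraph V) [DecidableRel G.Adj] (k : ℕ) : Matrix V V K :=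
  startMat G K * nbMat G K ^ k * (startMat G K).transpose

/-- The last dart only leaves the endpoint, so a walk is counted once per admissible continuation:
`d` times for length `0`, `d - 1` times afterwards. With this weighting the recursion holds from `k
= 0` on without an exceptional term. -/
theorem nbCount_zero (hd : G.IsRegularOfDegree d) :
    nbCount K G 0 = (d : K) • (1 : Matrix V V K) := by
  rw [nbCount, pow_zero, Matrix.mul_one, startMat_mul_transpose K hd]

theorem nbCount_one (hd : G.IsRegularOfDegree d) :
    nbCount K G 1 = ((d : K) - 1) • G.adjMatrix K := by
  have h : endMat G K * (startMat G K).transpose = G.adjMatrix K := by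
    have := congrArg Matrix.transpose (startMat_mul_endMat_transpose (G := G) K)
    rwa [Matrix.transpose_mul, Matrix.transpose_transpose, SimpleGraph.transpose_adjMatrix] at this
  rw [nbCount, pow_one, startMat_mul_nbMat, Matrix.sub_mul, Matrix.mul_assoc,
    startMat_mul_transpose K hd, h, Matrix.mul_smul, Matrix.mul_one, sub_smul, one_smul]

theorem nbCount_add_two (hd : G.IsRegularOfDegree d) (k : ℕ) :
    nbCount K G (k + 2) =
      G.adjMatrix K * nbCount K G (k + 1) - ((d : K) - 1) • nbCount K G k := by
  have h : startMat G K * nbMat G K ^ (k + 2) = G.adjMatrix K * (startMat G K * nbMat G K ^ (k + 1))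
      - ((d : K) - 1) • (startMat G K * nbMat G K ^ k) := by
    rw [pow_succ' _ (k + 1), ← Matrix.mul_assoc, startMat_mul_nbMat, Matrix.sub_mul,
      Matrix.mul_assoc]
    congr 1
    rw [pow_succ', ← Matrix.mul_assoc, endMat_mul_nbMat K hd, Matrix.smul_mul]
  simp only [nbCount]
  rw [h, Matrix.sub_mul, Matrix.smul_mul, Matrix.mul_assoc]

theorem adjMatrix_mulVec_one (hd : G.IsRegularOfDegree d) :
    (G.adjMatrix K).mulVec 1 = (d : K) • 1 := by
  ext v
  simpa [Matrix.mulVec, dotProduct, SimpleGraph.adjMatrix_apply] using sum_adj_eq K hd v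

theorem one_vecMul_startMat : Matrix.vecMul 1 (startMat G K) = 1 := by
  ext e
  simp [Matrix.vecMul, dotProduct, startMat]

theorem one_vecMul_endMat : Matrix.vecMul 1 (endMat G K) = 1 := by
  ext e
  simp [Matrix.vecMul, dotProduct, endMat]

theorem vecMul_one_adjMatrix (hd : G.IsRegularOfDegree d) :
    Matrix.vecMul 1 (G.adjMatrix K) = (d : K) • 1 := by
  rw [← SimpleGraph.transpose_adjMatrix, Matrix.vecMul_transpose, adjMatrix_mulVec_one K hd]

theorem one_vecMul_nbMat (hd : G.IsRegularOfDegree d) :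
    Matrix.vecMul 1 (nbMat G K) = ((d : K) - 1) • 1 := by
  rw [← one_vecMul_startMat, Matrix.vecMul_vecMul, startMat_mul_nbMat, Matrix.vecMul_sub,
    ← Matrix.vecMul_vecMul, vecMul_one_adjMatrix K hd, Matrix.smul_vecMul, one_vecMul_endMat,
    one_vecMul_startMat, sub_smul, one_smul]

theorem sum_nbMat_col (hd : G.IsRegularOfDegree d) (f : G.Dart) :
    ∑ e, nbMat G K e f = (d : K) - 1 := by
  simpa [Matrix.vecMul, dotProduct] using congrFun (one_vecMul_nbMat (G := G) K hd) f

/-- Reversing a non-backtracking walk keeps it non-backtracking; this turns column sums into row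
sums. -/
theorem nbMat_symm (e f : G.Dart) : nbMat G K e.symm f.symm = nbMat G K f e := by
  simp only [nbMat, SimpleGraph.Dart.symm_toProd, Prod.fst_swap, Prod.snd_swap]
  congr 1
  simp only [eq_comm, ne_eq]

theorem sum_nbMat_row (hd : G.IsRegularOfDegree d) (e : G.Dart) :
    ∑ f, nbMat G K e f = (d : K) - 1 := by
  rw [← sum_nbMat_col K hd e.symm]
  refine Fintype.sum_bijective _ SimpleGraph.Dart.symm_involutive.bijective _ _ fun f => ?_
  rw [nbMat_symm]

theorem vecMul_one_nbCount (hd : G.IsRegularOfDegree d) (k : ℕ) :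
    Matrix.vecMul 1 (nbCount K G k) = ((d : K) * ((d : K) - 1) ^ k) • 1 := by
  have h : ∀ k : ℕ, Matrix.vecMul 1 (nbMat G K ^ k) = ((d : K) - 1) ^ k • 1 := by
    intro k
    induction k with
    | zero => simp
    | succ k ih =>
      rw [pow_succ, ← Matrix.vecMul_vecMul, ih, Matrix.smul_vecMul, one_vecMul_nbMat K hd,
        smul_smul, pow_succ]
  have h2 : Matrix.vecMul 1 (startMat G K).transpose = (d : K) • 1 := by
    conv_lhs => rw [← one_vecMul_startMat (G := G)]
    rw [Matrix.vecMul_vecMul, startMat_mul_transpose K hd, Matrix.vecMul_smul, Matrix.vecMul_one]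
  rw [nbCount, ← Matrix.vecMul_vecMul, ← Matrix.vecMul_vecMul, one_vecMul_startMat, h,
    Matrix.smul_vecMul, h2, smul_smul, mul_comm]

/-- An eigenvector of the non-backtracking matrix either comes from the dart reversal or induces
an eigenvector of the adjacency matrix. -/
theorem nbMat_eigenvector (hd : G.IsRegularOfDegree d) {y : K} (hy : y ≠ 0) {f : G.Dart → K}
    (hf : f ≠ 0) (h : (nbMat G K).mulVec f = y • f) :
    y ^ 2 = 1 ∨ ((startMat G K).mulVec f ≠ 0 ∧ (G.adjMatrix K).mulVec ((startMat G K).mulVec f) =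
      (y + ((d : K) - 1) / y) • (startMat G K).mulVec f) := by
  have h1 : y • (endMat G K).mulVec f = ((d : K) - 1) • (startMat G K).mulVec f := by
    rw [← Matrix.mulVec_smul, ← h, Matrix.mulVec_mulVec, endMat_mul_nbMat K hd, Matrix.smul_mulVec]
  have h2 : y • (startMat G K).mulVec f =
      (G.adjMatrix K).mulVec ((startMat G K).mulVec f) - (endMat G K).mulVec f := by
    rw [← Matrix.mulVec_smul, ← h, Matrix.mulVec_mulVec, startMat_mul_nbMat, Matrix.sub_mulVec,
      Matrix.mulVec_mulVec]
  -- When `startMat` kills `f`, the matrix acts on `f` as minus the dart reversal, an involution.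
  -- Otherwise `h1` eliminates `endMat` from `h2`.
  by_cases hS : (startMat G K).mulVec f = 0
  · left
    have h3 : (revMat G K).mulVec f = -(y • f) := by
      rw [← h, nbMat_eq, Matrix.sub_mulVec, ← Matrix.mulVec_mulVec, hS, Matrix.mulVec_zero,
        zero_sub, neg_neg]
    have h4 : f = (y ^ 2) • f := by
      conv_lhs => rw [← Matrix.one_mulVec f, ← revMat_mul_revMat, ← Matrix.mulVec_mulVec, h3,
        Matrix.mulVec_neg, Matrix.mulVec_smul, h3, smul_neg, neg_neg, smul_smul]
      rw [sq]
    obtain ⟨e, he⟩ := Function.ne_iff.1 hf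
    have h5 := congrFun h4 e
    rw [Pi.smul_apply, smul_eq_mul] at h5
    exact (mul_right_cancel₀ he (by rw [one_mul]; exact h5)).symm
  · refine Or.inr ⟨hS, ?_⟩
    have h6 : (endMat G K).mulVec f = (((d : K) - 1) / y) • (startMat G K).mulVec f := by
      rw [div_eq_inv_mul, mul_smul, ← h1, smul_smul, inv_mul_cancel₀ hy, one_smul]
    rw [add_smul, h2, h6]
    abel

/-- Sum-zero dart functions thus induce sum-zero vertex functions, which excludes the trivial
eigenvalue `d`. -/
theorem sum_startMat_mulVec (f : G.Dart → K) : ∑ v, (startMat G K).mulVec f v = ∑ e, f e := by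
  have : Matrix.vecMul 1 (startMat G K) ⬝ᵥ f = ∑ e, f e := by
    rw [one_vecMul_startMat]; simp [dotProduct]
  rw [← this, ← Matrix.dotProduct_mulVec]
  simp [dotProduct]

end Incidence

/-! ### The second eigenvalue -/

section Second

variable {V : Type*} [Fintype V] [DecidableEq V] {G : SimpleGraph V} [DecidableRel G.Adj] {d : ℕ}

theorem lapMatrix_mulVec_of_regular (hd : G.IsRegularOfDegree d) (x : V → ℝ) :
    (G.lapMatrix ℝ).mulVec x = (d : ℝ) • x - (G.adjMatrix ℝ).mulVec x := by
  ext v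
  rw [SimpleGraph.lapMatrix_mulVec_apply, hd v, Pi.sub_apply, Pi.smul_apply, smul_eq_mul,
    SimpleGraph.adjMatrix_mulVec_apply]

/-- Eigenvectors of the adjacency matrix for the eigenvalue `d` are constant. -/
theorem eq_of_adjMatrix_mulVec_eq (hG : G.Connected) (hd : G.IsRegularOfDegree d) {x : V → ℝ}
    (hx : (G.adjMatrix ℝ).mulVec x = (d : ℝ) • x) (u v : V) : x u = x v := by
  have h : (G.lapMatrix ℝ).mulVec x = 0 := by rw [lapMatrix_mulVec_of_regular hd, hx, sub_self]
  exact (G.lapMatrix_mulVec_eq_zero_iff_forall_reachable.1 h) u v (hG.preconnected u v)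

/-- Eigenvalues of the adjacency matrix have modulus at most `d`. -/
theorem abs_le_of_adjMatrix_mulVec_eq (hd : G.IsRegularOfDegree d) {x : V → ℝ} (hx0 : x ≠ 0)
    {μ : ℝ} (hx : (G.adjMatrix ℝ).mulVec x = μ • x) : |μ| ≤ d := by
  obtain ⟨x0, hx0⟩ := Function.ne_iff.1 hx0
  have : Nonempty V := ⟨x0⟩
  obtain ⟨v, hv⟩ := Finite.exists_max fun v => |x v|
  have hpos : 0 < |x v| := (abs_pos.2 hx0).trans_le (hv x0)
  have h1 := congrFun hx v
  rw [Pi.smul_apply, smul_eq_mul, SimpleGraph.adjMatrix_mulVec_apply] at h1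
  refine le_of_mul_le_mul_right ?_ hpos
  rw [← abs_mul, ← h1, ← hd v, ← SimpleGraph.card_neighborFinset_eq_degree, ← nsmul_eq_mul]
  exact (Finset.abs_sum_le_sum_abs _ _).trans (Finset.sum_le_card_nsmul _ _ _ fun w _ => hv w)

theorem dotProduct_adjMatrix_mulVec_comm (x y : V → ℝ) :
    x ⬝ᵥ (G.adjMatrix ℝ).mulVec y = (G.adjMatrix ℝ).mulVec x ⬝ᵥ y := by
  rw [Matrix.dotProduct_mulVec, ← Matrix.mulVec_transpose, SimpleGraph.transpose_adjMatrix]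

/-- An eigenbasis of the adjacency matrix. -/
def eigvec (G : SimpleGraph V) [DecidableRel G.Adj] (j : V) : V → ℝ :=
  ⇑((G.isHermitian_adjMatrix ℝ).eigenvectorBasis j)

/-- The eigenvalues belonging to `eigvec`. -/
def eigval (G : SimpleGraph V) [DecidableRel G.Adj] (j : V) : ℝ :=
  (G.isHermitian_adjMatrix ℝ).eigenvalues j

theorem adjMatrix_mulVec_eigvec (j : V) :
    (G.adjMatrix ℝ).mulVec (eigvec G j) = eigval G j • eigvec G j :=
  (G.isHermitian_adjMatrix ℝ).mulVec_eigenvectorBasis j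

theorem eigvec_dotProduct (i j : V) : eigvec G i ⬝ᵥ eigvec G j = if i = j then 1 else 0 := by
  have h := orthonormal_iff_ite.1 (G.isHermitian_adjMatrix ℝ).eigenvectorBasis.orthonormal i j
  rw [← h, EuclideanSpace.inner_eq_star_dotProduct, star_trivial, dotProduct_comm]
  rfl

theorem sum_eigvec_dotProduct_mul (x y : V → ℝ) :
    ∑ j, (eigvec G j ⬝ᵥ x) * (eigvec G j ⬝ᵥ y) = x ⬝ᵥ y := by
  have h := (G.isHermitian_adjMatrix ℝ).eigenvectorBasis.sum_inner_mul_inner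
    (WithLp.toLp 2 x) (WithLp.toLp 2 y)
  simp only [EuclideanSpace.inner_eq_star_dotProduct, star_trivial] at h
  rw [dotProduct_comm x y, ← h]
  refine Finset.sum_congr rfl fun j _ => ?_
  rw [dotProduct_comm _ y]
  rfl

theorem eigvec_ne_zero (j : V) : eigvec G j ≠ 0 := by
  intro h
  have := eigvec_dotProduct (G := G) j j
  simp [h] at this

theorem eigvec_dotProduct_adjMatrix_mulVec (j : V) (x : V → ℝ) :
    eigvec G j ⬝ᵥ (G.adjMatrix ℝ).mulVec x = eigval G j * (eigvec G j ⬝ᵥ x) := by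
  rw [dotProduct_adjMatrix_mulVec_comm, adjMatrix_mulVec_eigvec, smul_dotProduct, smul_eq_mul]

/-- The index of the top eigenvalue: its eigenvector is constant, all others have sum zero, and
their eigenvalues are those which define `secondEigenvalue`. -/
theorem exists_top_index (hG : G.Connected) (hd : G.IsRegularOfDegree d) :
    ∃ j₀ : V, (∀ u v, eigvec G j₀ u = eigvec G j₀ v) ∧
      secondEigenvalue G = ⨆ j : {j : V // j ≠ j₀}, |eigval G j| := by
  have : Nonempty V := hG.nonempty
  have hcard : 0 < Fintype.card V := Fintype.card_pos
  -- This must be the equivalence used in the definition of `eigenvalues`, so that the two indexings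
  -- agree.
  let σ : Fin (Fintype.card V) ≃ V := Fintype.equivOfCardEq (Fintype.card_fin _)
  have hσ : ∀ i, eigval G (σ i) = (G.isHermitian_adjMatrix ℝ).eigenvalues₀ i := by
    intro i
    simp only [eigval, Matrix.IsHermitian.eigenvalues]
    congr 1
    exact σ.symm_apply_apply i
  let i₀ : Fin (Fintype.card V) := ⟨0, hcard⟩
  refine ⟨σ i₀, ?_, ?_⟩
  -- An eigenvector not orthogonal to the constants has eigenvalue `d`, so the top eigenvalue is `d`
  -- as well, and connectedness makes its eigenvector constant.
  · have hone : ∃ j, eigvec G j ⬝ᵥ (1 : V → ℝ) ≠ 0 := by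
      by_contra! h
      have h1 := sum_eigvec_dotProduct_mul (G := G) 1 1
      simp only [h, mul_zero, Finset.sum_const_zero, dotProduct_one, Pi.one_apply,
        Finset.sum_const, Finset.card_univ, nsmul_eq_mul, mul_one] at h1
      exact hcard.ne (by exact_mod_cast h1)
    obtain ⟨j, hj⟩ := hone
    have hjd : eigval G j = d := by
      have h1 := eigvec_dotProduct_adjMatrix_mulVec (G := G) j 1
      rw [adjMatrix_mulVec_one ℝ hd, dotProduct_smul, smul_eq_mul] at h1
      exact (mul_right_cancel₀ hj h1).symm
    have hle : eigval G j ≤ eigval G (σ i₀) := by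
      obtain ⟨i, rfl⟩ := σ.surjective j
      rw [hσ, hσ]
      exact (G.isHermitian_adjMatrix ℝ).eigenvalues₀_antitone (Nat.zero_le i.val)
    have hge : eigval G (σ i₀) ≤ d := (le_abs_self _).trans
      (abs_le_of_adjMatrix_mulVec_eq hd (eigvec_ne_zero _) (adjMatrix_mulVec_eigvec _))
    have heq : eigval G (σ i₀) = d := le_antisymm hge (hjd ▸ hle)
    refine eq_of_adjMatrix_mulVec_eq hG hd ?_
    rw [adjMatrix_mulVec_eigvec, heq]
  · rw [secondEigenvalue]
    refine Equiv.iSup_congr (σ.subtypeEquiv fun i => ?_) fun i => ?_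
    · rw [Ne, σ.injective.eq_iff, Fin.ext_iff, Nat.pos_iff_ne_zero]
    · simp [hσ]

theorem secondEigenvalue_nonneg : 0 ≤ secondEigenvalue G :=
  Real.iSup_nonneg fun _ => abs_nonneg _

theorem eigvec_dotProduct_eq_zero {j₀ : V} (h : ∀ u v, eigvec G j₀ u = eigvec G j₀ v)
    {x : V → ℝ} (hx : ∑ v, x v = 0) : eigvec G j₀ ⬝ᵥ x = 0 := by
  rw [dotProduct, Finset.sum_congr rfl fun v _ => by rw [h v j₀], ← Finset.mul_sum, hx, mul_zero]

theorem sum_eigvec_eq_zero {j₀ j : V} (h : ∀ u v, eigvec G j₀ u = eigvec G j₀ v) (hj : j ≠ j₀) :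
    ∑ v, eigvec G j v = 0 := by
  have h1 : eigvec G j₀ j₀ * ∑ v, eigvec G j v = 0 := by
    rw [← (eigvec_dotProduct (G := G) j₀ j).trans (if_neg hj.symm), Finset.mul_sum, dotProduct]
    exact Finset.sum_congr rfl fun v _ => by rw [h j₀ v]
  refine (mul_eq_zero.1 h1).resolve_left fun h2 => eigvec_ne_zero (G := G) j₀ ?_
  ext v
  rw [h v j₀, h2, Pi.zero_apply]

theorem exists_eigenvector_secondEigenvalue (hG : G.Connected) (hd : G.IsRegularOfDegree d)
    (hV : 1 < Fintype.card V) :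
    ∃ (μ : ℝ) (x : V → ℝ), x ≠ 0 ∧ ∑ v, x v = 0 ∧ (G.adjMatrix ℝ).mulVec x = μ • x ∧
      |μ| = secondEigenvalue G := by
  obtain ⟨j₀, hconst, hsup⟩ := exists_top_index hG hd
  obtain ⟨j₁, hj₁⟩ := Fintype.exists_ne_of_one_lt_card hV j₀
  have : Nonempty {j : V // j ≠ j₀} := ⟨⟨j₁, hj₁⟩⟩
  obtain ⟨j, hj⟩ := exists_eq_ciSup_of_finite (f := fun j : {j : V // j ≠ j₀} => |eigval G j|)
  exact ⟨eigval G j, eigvec G j, eigvec_ne_zero _, sum_eigvec_eq_zero hconst j.2,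
    adjMatrix_mulVec_eigvec _, by rw [hsup, hj]⟩

theorem secondEigenvalue_le (hG : G.Connected) (hd : G.IsRegularOfDegree d)
    (hV : 1 < Fintype.card V) : secondEigenvalue G ≤ d := by
  obtain ⟨μ, x, hx, -, h, hμ⟩ := exists_eigenvector_secondEigenvalue hG hd hV
  exact hμ ▸ abs_le_of_adjMatrix_mulVec_eq hd hx h

/-- In the eigenbasis a sum-zero vector has no component along the constant eigenvector. -/
theorem abs_dotProduct_adjMatrix_mulVec_le (hG : G.Connected) (hd : G.IsRegularOfDegree d)
    {x : V → ℝ} (hx : ∑ v, x v = 0) :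
    |x ⬝ᵥ (G.adjMatrix ℝ).mulVec x| ≤ secondEigenvalue G * (x ⬝ᵥ x) := by
  obtain ⟨j₀, hconst, hsup⟩ := exists_top_index hG hd
  rw [← sum_eigvec_dotProduct_mul (G := G) x x, ← sum_eigvec_dotProduct_mul (G := G) x,
    Finset.mul_sum]
  refine (Finset.abs_sum_le_sum_abs _ _).trans (Finset.sum_le_sum fun j _ => ?_)
  rw [eigvec_dotProduct_adjMatrix_mulVec]
  by_cases hj : j = j₀
  · rw [hj, eigvec_dotProduct_eq_zero hconst hx]; simp
  · have h1 : |eigval G j| ≤ secondEigenvalue G := by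
      rw [hsup]
      exact le_ciSup (f := fun j : {j : V // j ≠ j₀} => |eigval G j|)
        (Set.finite_range _).bddAbove ⟨j, hj⟩
    rw [mul_left_comm, abs_mul, abs_of_nonneg (mul_self_nonneg (eigvec G j ⬝ᵥ x))]
    exact mul_le_mul_of_nonneg_right h1 (mul_self_nonneg _)

/-- Complex eigenvectors with sum zero have real eigenvalues bounded by `secondEigenvalue`. -/
theorem exists_real_of_complex_eigenvector (hG : G.Connected) (hd : G.IsRegularOfDegree d)
    {z : ℂ} {f : V → ℂ} (hf : f ≠ 0) (hsum : ∑ v, f v = 0)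
    (h : (G.adjMatrix ℂ).mulVec f = z • f) :
    ∃ μ : ℝ, z = μ ∧ |μ| ≤ secondEigenvalue G := by
  obtain ⟨j₀, hconst, hsup⟩ := exists_top_index hG hd
  -- The coefficients of `f` in the real eigenbasis; at any nonzero one, `z` must equal the real
  -- eigenvalue.
  let c : V → ℂ := fun j => ⟨eigvec G j ⬝ᵥ fun v => (f v).re, eigvec G j ⬝ᵥ fun v => (f v).im⟩
  have hre : (G.adjMatrix ℝ).mulVec (fun v => (f v).re) = fun v => (z * f v).re := by
    ext v
    have := congrArg Complex.re (congrFun h v)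
    rw [SimpleGraph.adjMatrix_mulVec_apply, Complex.re_sum] at this
    rw [SimpleGraph.adjMatrix_mulVec_apply, this]; rfl
  have him : (G.adjMatrix ℝ).mulVec (fun v => (f v).im) = fun v => (z * f v).im := by
    ext v
    have := congrArg Complex.im (congrFun h v)
    rw [SimpleGraph.adjMatrix_mulVec_apply, Complex.im_sum] at this
    rw [SimpleGraph.adjMatrix_mulVec_apply, this]; rfl
  have hc : ∃ j, c j ≠ 0 := by
    by_contra! hc
    have h1 : ∀ j, eigvec G j ⬝ᵥ (fun v => (f v).re) = 0 := fun j => congrArg Complex.re (hc j)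
    have h2 : ∀ j, eigvec G j ⬝ᵥ (fun v => (f v).im) = 0 := fun j => congrArg Complex.im (hc j)
    have h3 := sum_eigvec_dotProduct_mul (G := G) (fun v => (f v).re) (fun v => (f v).re)
    have h4 := sum_eigvec_dotProduct_mul (G := G) (fun v => (f v).im) (fun v => (f v).im)
    simp only [h1, h2, mul_zero, Finset.sum_const_zero] at h3 h4
    refine hf (funext fun v => Complex.ext ?_ ?_)
    · exact congrFun (dotProduct_self_eq_zero.1 h3.symm) v
    · exact congrFun (dotProduct_self_eq_zero.1 h4.symm) v
  obtain ⟨j, hj⟩ := hc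
  have hjj : j ≠ j₀ := by
    rintro rfl
    refine hj (Complex.ext ?_ ?_)
    · exact eigvec_dotProduct_eq_zero hconst (by rw [← Complex.re_sum, hsum, Complex.zero_re])
    · exact eigvec_dotProduct_eq_zero hconst (by rw [← Complex.im_sum, hsum, Complex.zero_im])
  have hcz : (eigval G j : ℂ) * c j = z * c j := by
    refine Complex.ext ?_ ?_
    · rw [Complex.re_ofReal_mul, Complex.mul_re]
      change eigval G j * (eigvec G j ⬝ᵥ fun v => (f v).re) =
        z.re * (eigvec G j ⬝ᵥ fun v => (f v).re) - z.im * (eigvec G j ⬝ᵥ fun v => (f v).im)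
      rw [← eigvec_dotProduct_adjMatrix_mulVec, hre]
      simp only [dotProduct, Finset.mul_sum, ← Finset.sum_sub_distrib, Complex.mul_re]
      exact Finset.sum_congr rfl fun v _ => by ring
    · rw [Complex.im_ofReal_mul, Complex.mul_im]
      change eigval G j * (eigvec G j ⬝ᵥ fun v => (f v).im) =
        z.re * (eigvec G j ⬝ᵥ fun v => (f v).im) + z.im * (eigvec G j ⬝ᵥ fun v => (f v).re)
      rw [← eigvec_dotProduct_adjMatrix_mulVec, him]
      simp only [dotProduct, Finset.mul_sum, ← Finset.sum_add_distrib, Complex.mul_im]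
      exact Finset.sum_congr rfl fun v _ => by ring
  refine ⟨eigval G j, (mul_right_cancel₀ hj hcz).symm, ?_⟩
  rw [hsup]
  exact le_ciSup (f := fun j : {j : V // j ≠ j₀} => |eigval G j|)
    (Set.finite_range _).bddAbove ⟨j, hjj⟩

theorem lt_card_of_regular [Nonempty V] (hd : G.IsRegularOfDegree d) : d < Fintype.card V := by
  rw [← hd (Classical.arbitrary V)]
  exact G.degree_lt_card_verts _

/-- The difference of the indicators of two adjacent vertices has Rayleigh quotient `-1`. The bound
keeps the rates positive. -/
theorem one_le_secondEigenvalue (hG : G.Connected) (hd : G.IsRegularOfDegree d) (hd0 : 0 < d) :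
    1 ≤ secondEigenvalue G := by
  obtain ⟨u⟩ := hG.nonempty
  obtain ⟨w, huw⟩ := (G.degree_pos_iff_exists_adj u).1 (by rw [hd u]; exact hd0)
  have hne : u ≠ w := huw.ne
  let x : V → ℝ := Pi.single u 1 - Pi.single w 1
  have hx : ∑ v, x v = 0 := by simp [x]
  have h := abs_dotProduct_adjMatrix_mulVec_le hG hd hx
  have h1 : x ⬝ᵥ x = 2 := by
    simp [x, dotProduct_sub, hne, hne.symm]; norm_num
  have h2 : x ⬝ᵥ (G.adjMatrix ℝ).mulVec x = -2 := by
    simp [x, sub_dotProduct, Matrix.mulVec_sub, dotProduct_sub, SimpleGraph.adjMatrix_apply,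
      huw, huw.symm]
    norm_num
  rw [h1, h2] at h
  norm_num at h
  linarith

end Second

/-! ### The largest root of `y + q / y = μ` -/

/-- The largest modulus of a solution of `y + q / y = μ` with `μ` real, `|μ| ≤ l`. -/
def nbRoot (q l : ℝ) : ℝ := max (Real.sqrt q) ((l + Real.sqrt (l ^ 2 - 4 * q)) / 2)

/-- A nonreal solution is paired with its conjugate, and the product of the two roots is `q`, so its
modulus is `√q`. For real `y`, `t = |y|` satisfies `t ^ 2 + q ≤ l * t`, so it is at most the larger
root. -/
theorem norm_le_nbRoot {q l μ : ℝ} {y : ℂ} (hy : y ≠ 0) (h : y + q / y = μ)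
    (hμ : |μ| ≤ l) : ‖y‖ ≤ nbRoot q l := by
  have h1 : y * y + q = μ * y := by rw [← h]; field_simp
  have hre : y.re * y.re - y.im * y.im + q = μ * y.re := by simpa using congrArg Complex.re h1
  have him : y.re * y.im + y.im * y.re = μ * y.im := by simpa using congrArg Complex.im h1
  have hnorm : ‖y‖ ^ 2 = y.re ^ 2 + y.im ^ 2 := by rw [Complex.sq_norm, Complex.normSq_apply]; ring
  by_cases hb : y.im = 0
  · refine le_max_of_le_right ?_
    rw [hb] at hre hnorm
    have h2 : ‖y‖ ^ 2 + q ≤ l * ‖y‖ := by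
      calc ‖y‖ ^ 2 + q = μ * y.re := by rw [hnorm]; linarith
        _ ≤ |μ| * |y.re| := by rw [← abs_mul]; exact le_abs_self _
        _ ≤ l * ‖y‖ := mul_le_mul hμ (Complex.abs_re_le_norm y) (abs_nonneg _)
            ((abs_nonneg _).trans hμ)
    have h3 : 2 * ‖y‖ - l ≤ Real.sqrt (l ^ 2 - 4 * q) := Real.le_sqrt_of_sq_le (by nlinarith)
    linarith
  · refine le_max_of_le_left (Real.le_sqrt_of_sq_le ?_)
    have h2 : μ = 2 * y.re := mul_right_cancel₀ hb (by linarith)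
    rw [h2] at hre
    rw [hnorm]
    linarith

theorem exists_norm_eq_nbRoot (q μ : ℝ) :
    ∃ α : ℂ, α ^ 2 - μ * α + q = 0 ∧ ‖α‖ = nbRoot q |μ| := by
  rw [nbRoot, sq_abs]
  rcases lt_or_ge (μ ^ 2) (4 * q) with h | h
  · refine ⟨⟨μ / 2, Real.sqrt (4 * q - μ ^ 2) / 2⟩, ?_, ?_⟩
    · have hs := Real.sq_sqrt (show 0 ≤ 4 * q - μ ^ 2 by linarith)
      apply Complex.ext
      · simp only [sq] at hs ⊢
        simp
        nlinarith
      · simp [sq]; ring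
    · have hs := Real.sq_sqrt (show 0 ≤ 4 * q - μ ^ 2 by linarith)
      -- The square root of a negative number is `0`, so the second entry of the maximum is `|μ| /
      -- 2`, which is below `√q`.
      rw [Real.sqrt_eq_zero_of_nonpos (show μ ^ 2 - 4 * q ≤ 0 by linarith), add_zero, max_eq_left]
      · rw [Complex.norm_def, Complex.normSq_apply]
        congr 1
        change μ / 2 * (μ / 2) + _ / 2 * (_ / 2) = q
        nlinarith
      · refine Real.le_sqrt_of_sq_le ?_
        rw [div_pow, sq_abs]; linarith
  · have hs := Real.sq_sqrt (show 0 ≤ μ ^ 2 - 4 * q by linarith)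
    have hs0 := Real.sqrt_nonneg (μ ^ 2 - 4 * q)
    set s := Real.sqrt (μ ^ 2 - 4 * q)
    have hmax : max (Real.sqrt q) ((|μ| + s) / 2) = (|μ| + s) / 2 := by
      refine max_eq_right (Real.sqrt_le_iff.2 ⟨by positivity, ?_⟩)
      nlinarith [sq_abs μ, mul_nonneg (abs_nonneg μ) hs0]
    rw [hmax]
    rcases le_total 0 μ with h0 | h0
    · refine ⟨(((μ + s) / 2 : ℝ) : ℂ), ?_, ?_⟩
      · norm_cast; nlinarith
      · rw [Complex.norm_real, Real.norm_eq_abs, abs_of_nonneg (by positivity), abs_of_nonneg h0]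
    · refine ⟨(((μ - s) / 2 : ℝ) : ℂ), ?_, ?_⟩
      · norm_cast; nlinarith
      · rw [Complex.norm_real, Real.norm_eq_abs, abs_of_nonpos (by linarith), abs_of_nonpos h0]
        ring

/-- The eigenvalue of `nbCount` belonging to the adjacency eigenvalue `μ`. -/
def nbCountEig (q μ : ℝ) : ℕ → ℝ
  | 0 => q + 1
  | 1 => q * μ
  | k + 2 => μ * nbCountEig q μ (k + 1) - q * nbCountEig q μ k

/-- With roots `α` and `β = μ - α`, the combination `a (k+1) - β * a k` equals `α ^ k * (q * α -
β)`, of modulus at least `(q - 1) * θ ^ (k+1)`, because `|β| ≤ |α| = θ`. Two consecutive terms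
therefore cannot both be small, whence the factor `1/2`. Single terms may be small, since complex
roots make the sequence oscillate. -/
theorem frequently_le_abs_nbCountEig {q μ : ℝ} (hq : 1 < q) :
    ∃ᶠ k in atTop, (q - 1) / 2 * nbRoot q |μ| ^ k ≤ |nbCountEig q μ k| := by
  have hq0 : 0 < q := by linarith
  obtain ⟨α, hα, hnorm⟩ := exists_norm_eq_nbRoot q μ
  set θ := nbRoot q |μ| with hθ
  have hθq : Real.sqrt q ≤ θ := le_max_left _ _
  have hθ0 : 0 < θ := (Real.sqrt_pos.2 hq0).trans_le hθq
  have hα0 : α ≠ 0 := by rw [← norm_pos_iff, hnorm]; exact hθ0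
  have hβ : ‖(μ : ℂ) - α‖ ≤ θ := by
    have h1 : (μ : ℂ) - α = q / α := by
      rw [eq_div_iff hα0]; linear_combination -hα
    rw [h1, norm_div, hnorm, Complex.norm_real, Real.norm_eq_abs, abs_of_pos hq0,
      div_le_iff₀ hθ0, ← sq]
    calc q = Real.sqrt q ^ 2 := (Real.sq_sqrt hq0.le).symm
      _ ≤ θ ^ 2 := by gcongr
  have hrec : ∀ k, (nbCountEig q μ (k + 1) : ℂ) - (μ - α) * nbCountEig q μ k =
      α ^ k * (q * α - (μ - α)) := by
    intro k
    induction k with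
    | zero => simp only [nbCountEig]; push_cast; ring
    | succ k ih =>
      rw [pow_succ', mul_assoc, ← ih]
      simp only [nbCountEig]
      push_cast
      linear_combination -(nbCountEig q μ k : ℂ) * hα
  have hge : ∀ k, (q - 1) * θ ^ (k + 1) ≤ |nbCountEig q μ (k + 1)| + θ * |nbCountEig q μ k| := by
    intro k
    calc (q - 1) * θ ^ (k + 1) = θ ^ k * (q * θ - θ) := by ring
      _ ≤ ‖α ^ k * (q * α - (μ - α))‖ := by
          rw [norm_mul, norm_pow, hnorm]
          refine mul_le_mul_of_nonneg_left ?_ (by positivity)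
          refine le_trans ?_ (norm_sub_norm_le _ _)
          rw [norm_mul, hnorm, Complex.norm_real, Real.norm_eq_abs, abs_of_pos hq0]
          linarith
      _ ≤ _ := by
          rw [← hrec]
          refine (norm_sub_le _ _).trans ?_
          rw [norm_mul, Complex.norm_real, Complex.norm_real, Real.norm_eq_abs, Real.norm_eq_abs]
          gcongr
  intro hev
  obtain ⟨K, hK⟩ := eventually_atTop.1 hev
  have h1 := not_le.1 (hK K le_rfl)
  have h2 := not_le.1 (hK (K + 1) (Nat.le_succ K))
  have h3 := hge K
  have h4 := mul_lt_mul_of_pos_left h1 hθ0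
  rw [pow_succ] at h2 h3
  nlinarith

/-! ### The mixing rates of a regular graph -/

section Regular

variable {V : Type*} [Fintype V] [DecidableEq V] {G : SimpleGraph V} [DecidableRel G.Adj] {d : ℕ}

theorem vol_eq (hd : G.IsRegularOfDegree d) : vol G = Fintype.card V * (d : ℝ) := by
  simp [vol, hd.degree_eq]

theorem stationary_eq (hd : G.IsRegularOfDegree d) (hd0 : 0 < d) (v : V) :
    stationary G v = 1 / (Fintype.card V : ℝ) := by
  have : (d : ℝ) ≠ 0 := by positivity
  have : Nonempty V := ⟨v⟩
  rw [stationary, vol_eq hd, hd v]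
  field_simp

theorem card_dart_eq (hd : G.IsRegularOfDegree d) :
    Fintype.card G.Dart = Fintype.card V * d := by
  rw [G.dart_card_eq_sum_degrees]
  simp [hd.degree_eq]

theorem nbStationary_eq (hd : G.IsRegularOfDegree d) (e : G.Dart) :
    nbStationary G e = 1 / (Fintype.card G.Dart : ℝ) := by
  rw [nbStationary, vol_eq hd, card_dart_eq hd]
  push_cast; rfl

theorem transition_eq (hd : G.IsRegularOfDegree d) :
    transition G = (1 / (d : ℝ)) • G.adjMatrix ℝ := by
  ext u v
  simp only [transition, hd u, Matrix.smul_apply, SimpleGraph.adjMatrix_apply, smul_eq_mul]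
  split_ifs <;> simp

theorem nbTransition_eq (hd : G.IsRegularOfDegree d) :
    nbTransition G = (1 / ((d : ℝ) - 1)) • nbMat G ℝ := by
  ext e f
  simp only [nbTransition, hd e.snd, Matrix.smul_apply, nbMat, smul_eq_mul]
  split_ifs <;> simp

theorem nbVertexTransition_eq_mul (hd : G.IsRegularOfDegree d) (k : ℕ) :
    nbVertexTransition G k = (1 / (d : ℝ)) •
      (startMat G ℝ * nbTransition G ^ k * (startMat G ℝ).transpose) := by
  ext u v
  simp only [nbVertexTransition, hd u, Matrix.smul_apply, smul_eq_mul, Matrix.mul_apply,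
    startMat, Matrix.transpose_apply, Finset.sum_mul, Finset.mul_sum]
  rw [Finset.sum_comm]
  refine Finset.sum_congr rfl fun f _ => Finset.sum_congr rfl fun e _ => ?_
  by_cases h1 : e.fst = u <;> by_cases h2 : f.fst = v <;> simp [h1, h2]

theorem nbVertexTransition_eq (hd : G.IsRegularOfDegree d) (k : ℕ) :
    nbVertexTransition G k = (1 / ((d : ℝ) * ((d : ℝ) - 1) ^ k)) • nbCount ℝ G k := by
  rw [nbVertexTransition_eq_mul hd, nbTransition_eq hd, nbCount, smul_pow, Matrix.mul_smul,
    Matrix.smul_mul, smul_smul, one_div_pow, one_div_mul_one_div]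

/-- Since the vertex error is a compression of the dart error, upper bounds pass from darts to
vertices and lower bounds from vertices to darts. -/
theorem nbVertexTransition_sub_avg (hd : G.IsRegularOfDegree d) (hd0 : 0 < d) (k : ℕ) :
    nbVertexTransition G k - avg V ℝ = (1 / (d : ℝ)) •
      (startMat G ℝ * (nbTransition G ^ k - avg G.Dart ℝ) * (startMat G ℝ).transpose) := by
  rw [nbVertexTransition_eq_mul hd, Matrix.mul_sub, Matrix.sub_mul, smul_sub]
  congr 1
  have hrow : ∀ v : V, ∑ e, startMat G ℝ v e = d := by
    intro v
    simp only [startMat]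
    rw [sum_dart (fun a _ => if a = v then (1 : ℝ) else 0), Finset.sum_eq_single v]
    · simpa using sum_adj_eq ℝ hd v
    · intro a _ ha; simp [ha]
    · simp
  have hd' : (d : ℝ) ≠ 0 := by positivity
  ext u v
  have : Nonempty V := ⟨u⟩
  have hV : (Fintype.card V : ℝ) ≠ 0 := by exact_mod_cast Fintype.card_ne_zero
  simp only [Matrix.smul_apply, Matrix.mul_apply, avg, Matrix.transpose_apply, smul_eq_mul,
    ← Finset.sum_mul, ← Finset.mul_sum, hrow, card_dart_eq hd]
  push_cast
  field_simp

theorem abs_nbVertexTransition_sub_le (hd : G.IsRegularOfDegree d) (hd0 : 0 < d) {k : ℕ} {ε : ℝ}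
    (h : ∀ e f, |(nbTransition G ^ k) e f - 1 / (Fintype.card G.Dart : ℝ)| ≤ ε) (u v : V) :
    |nbVertexTransition G k u v - 1 / (Fintype.card V : ℝ)| ≤ (Fintype.card G.Dart : ℝ) ^ 2 * ε := by
  have h1 := congrFun (congrFun (nbVertexTransition_sub_avg hd hd0 k) u) v
  rw [Matrix.sub_apply, avg, Matrix.smul_apply, smul_eq_mul] at h1
  have hd1 : |1 / (d : ℝ)| ≤ 1 := by
    rw [abs_of_nonneg (by positivity)]
    exact div_le_one_of_le₀ (by exact_mod_cast hd0) (by positivity)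
  rw [h1, abs_mul]
  refine (mul_le_of_le_one_left (abs_nonneg _) hd1).trans ?_
  have hS : ∀ w e, |startMat G ℝ w e| ≤ 1 := by
    intro w e; simp only [startMat]; split_ifs <;> simp
  simp only [Matrix.mul_apply, Matrix.transpose_apply]
  have h2 : ∀ f, |∑ e, startMat G ℝ u e * (nbTransition G ^ k - avg G.Dart ℝ) e f| ≤
      Fintype.card G.Dart * ε := by
    intro f
    refine (Finset.abs_sum_le_sum_abs _ _).trans ?_
    refine (Finset.sum_le_card_nsmul _ _ ε fun e _ => ?_).trans_eq ?_
    · rw [abs_mul]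
      exact (mul_le_of_le_one_left (abs_nonneg _) (hS u e)).trans (h e f)
    · rw [nsmul_eq_mul, Finset.card_univ]
  refine (Finset.abs_sum_le_sum_abs _ _).trans ?_
  refine (Finset.sum_le_card_nsmul _ _ (Fintype.card G.Dart * ε) fun f _ => ?_).trans_eq ?_
  · rw [abs_mul]
    exact (mul_le_of_le_one_right (abs_nonneg _) (hS v f)).trans (h2 f)
  · rw [nsmul_eq_mul, Finset.card_univ]; ring

theorem eventually_abs_transition_sub_le (hG : G.Connected) (hd : G.IsRegularOfDegree d)
    (hd0 : 0 < d) {s : ℝ} (hs : secondEigenvalue G / d < s) :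
    ∀ᶠ t : ℕ in atTop, ∀ u v,
      |(transition G ^ t) u v - 1 / (Fintype.card V : ℝ)| ≤ s ^ t := by
  have : Nonempty V := hG.nonempty
  have hd' : (d : ℝ) ≠ 0 := by positivity
  have hdc : (d : ℂ) ≠ 0 := by exact_mod_cast hd0.ne'
  have hrow : ∀ u, ∑ v, transition G u v = 1 := by
    intro u
    simp only [transition_eq hd, Matrix.smul_apply, smul_eq_mul, SimpleGraph.adjMatrix_apply,
      ← Finset.mul_sum, sum_adj_eq ℝ hd]
    field_simp
  have hcol : ∀ v, ∑ u, transition G u v = 1 := by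
    intro v
    rw [← hrow v]
    refine Finset.sum_congr rfl fun u _ => ?_
    simp [transition_eq hd, SimpleGraph.adjMatrix_apply, G.adj_comm u v]
  have hmap : (transition G).map Complex.ofReal = (1 / (d : ℂ)) • G.adjMatrix ℂ := by
    ext u v
    simp only [transition_eq hd, Matrix.map_apply, Matrix.smul_apply, smul_eq_mul,
      SimpleGraph.adjMatrix_apply]
    split_ifs <;> simp
  refine eventually_abs_pow_sub_le (div_nonneg secondEigenvalue_nonneg (by positivity))
    hrow hcol ?_ hs
  intro z f _ hf hsum h
  rw [hmap, Matrix.smul_mulVec] at h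
  have h1 : (G.adjMatrix ℂ).mulVec f = ((d : ℂ) * z) • f := by
    rw [mul_smul, ← h, smul_smul, mul_one_div_cancel hdc, one_smul]
  obtain ⟨μ, hμ, hle⟩ := exists_real_of_complex_eigenvector hG hd hf hsum h1
  have h2 := congrArg norm hμ
  rw [norm_mul, Complex.norm_natCast, Complex.norm_real, Real.norm_eq_abs] at h2
  rw [le_div_iff₀ (by positivity), mul_comm, h2]
  exact hle

theorem one_lt_natCast_sub_one (hd3 : 3 ≤ d) : (1 : ℝ) < (d : ℝ) - 1 := by
  have : (3 : ℝ) ≤ d := by exact_mod_cast hd3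
  linarith

theorem one_le_nbRoot {q l : ℝ} (hq : 1 ≤ q) : 1 ≤ nbRoot q l :=
  le_max_of_le_left (Real.one_le_sqrt.2 hq)

theorem eventually_abs_nbTransition_sub_le (hG : G.Connected) (hd : G.IsRegularOfDegree d)
    (hd3 : 3 ≤ d) {s : ℝ} (hs : nbRoot ((d : ℝ) - 1) (secondEigenvalue G) / ((d : ℝ) - 1) < s) :
    ∀ᶠ t : ℕ in atTop, ∀ e f,
      |(nbTransition G ^ t) e f - 1 / (Fintype.card G.Dart : ℝ)| ≤ s ^ t := by
  have : Nonempty V := hG.nonempty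
  have : Nonempty G.Dart := by
    rw [← Fintype.card_pos_iff, card_dart_eq hd]
    exact Nat.mul_pos Fintype.card_pos (by omega)
  have hq1 := one_lt_natCast_sub_one hd3
  have hq : (d : ℝ) - 1 ≠ 0 := by linarith
  have hqc : (d : ℂ) - 1 ≠ 0 := by exact_mod_cast Complex.ofReal_ne_zero.2 hq
  have hroot := one_le_nbRoot (l := secondEigenvalue G) hq1.le
  have hrow : ∀ e, ∑ f, nbTransition G e f = 1 := by
    intro e
    simp only [nbTransition_eq hd, Matrix.smul_apply, smul_eq_mul, ← Finset.mul_sum,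
      sum_nbMat_row ℝ hd]
    field_simp
  have hcol : ∀ f, ∑ e, nbTransition G e f = 1 := by
    intro f
    simp only [nbTransition_eq hd, Matrix.smul_apply, smul_eq_mul, ← Finset.mul_sum,
      sum_nbMat_col ℝ hd]
    field_simp
  have hmap : (nbTransition G).map Complex.ofReal = (1 / ((d : ℂ) - 1)) • nbMat G ℂ := by
    ext e f
    simp only [nbTransition_eq hd, Matrix.map_apply, Matrix.smul_apply, smul_eq_mul, nbMat]
    split_ifs <;> simp
  refine eventually_abs_pow_sub_le (div_nonneg (by linarith) (by linarith)) hrow hcol ?_ hs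
  intro z f hz hf hsum h
  rw [hmap, Matrix.smul_mulVec] at h
  have h1 : (nbMat G ℂ).mulVec f = (((d : ℂ) - 1) * z) • f := by
    rw [mul_smul, ← h, smul_smul, mul_one_div_cancel hqc, one_smul]
  have hy0 : ((d : ℂ) - 1) * z ≠ 0 := mul_ne_zero hqc hz
  have hnorm : ‖((d : ℂ) - 1) * z‖ = ((d : ℝ) - 1) * ‖z‖ := by
    have : (d : ℂ) - 1 = (((d : ℝ) - 1 : ℝ) : ℂ) := by push_cast; rfl
    rw [norm_mul, this, Complex.norm_real, Real.norm_eq_abs, abs_of_pos (by linarith)]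
  rw [le_div_iff₀ (by linarith), mul_comm, ← hnorm]
  -- The eigenvalues `±1` coming from reversal are harmless because `nbRoot` is at least `1`.
  rcases nbMat_eigenvector ℂ hd hy0 hf h1 with h2 | ⟨h2, h3⟩
  · have h4 : ‖((d : ℂ) - 1) * z‖ ^ 2 = 1 := by rw [← norm_pow, h2, norm_one]
    nlinarith [norm_nonneg (((d : ℂ) - 1) * z)]
  · obtain ⟨μ, hμ, hle⟩ := exists_real_of_complex_eigenvector hG hd h2
      (by rw [sum_startMat_mulVec, hsum]) h3
    refine norm_le_nbRoot hy0 ?_ hle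
    rw [← hμ]; push_cast; rfl

theorem adjMatrix_pow_mulVec {x : V → ℝ} {μ : ℝ} (h : (G.adjMatrix ℝ).mulVec x = μ • x) (t : ℕ) :
    (G.adjMatrix ℝ ^ t).mulVec x = μ ^ t • x := by
  induction t with
  | zero => simp
  | succ t ih => rw [pow_succ, ← Matrix.mulVec_mulVec, h, Matrix.mulVec_smul, ih, smul_smul, pow_succ']

theorem nbCount_mulVec (hd : G.IsRegularOfDegree d) {x : V → ℝ} {μ : ℝ}
    (h : (G.adjMatrix ℝ).mulVec x = μ • x) (k : ℕ) :
    (nbCount ℝ G k).mulVec x = nbCountEig ((d : ℝ) - 1) μ k • x := by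
  induction k using Nat.twoStepInduction with
  | zero => rw [nbCount_zero ℝ hd, Matrix.smul_mulVec, Matrix.one_mulVec, nbCountEig]; congr 1; ring
  | one => rw [nbCount_one ℝ hd, Matrix.smul_mulVec, h, smul_smul, nbCountEig]
  | more k ih0 ih1 =>
    rw [nbCount_add_two ℝ hd, Matrix.sub_mulVec, ← Matrix.mulVec_mulVec, ih1, Matrix.mulVec_smul,
      Matrix.smul_mulVec, ih0, h, smul_smul, smul_smul, ← sub_smul, nbCountEig]
    congr 1; ring

theorem exists_transition_entry_ge (hG : G.Connected) (hd : G.IsRegularOfDegree d) (hd0 : 0 < d)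
    (t : ℕ) : ∃ u v, (secondEigenvalue G / d) ^ t / Fintype.card V ≤
      |(transition G ^ t) u v - 1 / (Fintype.card V : ℝ)| := by
  have : Nonempty V := hG.nonempty
  have hV : 1 < Fintype.card V := by have := lt_card_of_regular hd; omega
  obtain ⟨μ, x, hx, hsum, h, hμ⟩ := exists_eigenvector_secondEigenvalue hG hd hV
  have h1 : (transition G ^ t - avg V ℝ).mulVec x = ((1 / (d : ℝ)) ^ t * μ ^ t) • x := by
    rw [Matrix.sub_mulVec, avg_mulVec_eq_zero hsum, sub_zero, transition_eq hd, smul_pow,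
      Matrix.smul_mulVec, adjMatrix_pow_mulVec h, smul_smul]
  obtain ⟨u, v, huv⟩ := exists_abs_entry_ge_of_mulVec_eq hx h1
  refine ⟨u, v, ?_⟩
  rw [← mul_pow, abs_pow, abs_mul, hμ, abs_of_nonneg (by positivity : 0 ≤ 1 / (d : ℝ)),
    one_div_mul_eq_div] at huv
  exact huv

theorem frequently_nbVertexTransition_entry_ge (hG : G.Connected) (hd : G.IsRegularOfDegree d)
    (hd3 : 3 ≤ d) : ∃ c : ℝ, 0 < c ∧ ∃ᶠ t : ℕ in atTop, ∃ u v,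
      c * (nbRoot ((d : ℝ) - 1) (secondEigenvalue G) / ((d : ℝ) - 1)) ^ t ≤
        |nbVertexTransition G t u v - 1 / (Fintype.card V : ℝ)| := by
  have : Nonempty V := hG.nonempty
  have hV : 1 < Fintype.card V := by have := lt_card_of_regular hd; omega
  have hVpos : (0 : ℝ) < Fintype.card V := by exact_mod_cast Fintype.card_pos
  have hq1 := one_lt_natCast_sub_one hd3
  have hd' : (0 : ℝ) < d := by linarith
  obtain ⟨μ, x, hx, hsum, h, hμ⟩ := exists_eigenvector_secondEigenvalue hG hd hV
  -- The factor `(q - 1) / 2` comes from the scalar recursion, `1 / d` from the first step of the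
  -- walk, `1 / n` from passing from an eigenvalue to an entry.
  refine ⟨((d : ℝ) - 1 - 1) / 2 / d / Fintype.card V, ?_, ?_⟩
  · have : 0 < (d : ℝ) - 1 - 1 := by linarith
    positivity
  refine (frequently_le_abs_nbCountEig (μ := μ) hq1).mono fun t ht => ?_
  have h1 : (nbVertexTransition G t - avg V ℝ).mulVec x =
      (1 / ((d : ℝ) * ((d : ℝ) - 1) ^ t) * nbCountEig ((d : ℝ) - 1) μ t) • x := by
    rw [Matrix.sub_mulVec, avg_mulVec_eq_zero hsum, sub_zero, nbVertexTransition_eq hd,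
      Matrix.smul_mulVec, nbCount_mulVec hd h, smul_smul]
  obtain ⟨u, v, huv⟩ := exists_abs_entry_ge_of_mulVec_eq hx h1
  refine ⟨u, v, le_trans ?_ huv⟩
  have hqt : 0 < ((d : ℝ) - 1) ^ t := pow_pos (by linarith) t
  rw [hμ] at ht
  rw [abs_mul, abs_of_pos (by positivity), div_pow]
  calc _ = 1 / ((d : ℝ) * ((d : ℝ) - 1) ^ t) *
        (((d : ℝ) - 1 - 1) / 2 * nbRoot ((d : ℝ) - 1) (secondEigenvalue G) ^ t) /
        Fintype.card V := by field_simp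
    _ ≤ _ := by gcongr

theorem mixingRate_eq (hG : G.Connected) (hd : G.IsRegularOfDegree d) (hd0 : 0 < d) :
    mixingRate G = secondEigenvalue G / d ∧ chiMixingRate G = secondEigenvalue G / d := by
  have : Nonempty V := hG.nonempty
  have hVpos : (0 : ℝ) < Fintype.card V := by exact_mod_cast Fintype.card_pos
  have hr : 0 < secondEigenvalue G / d :=
    div_pos (one_pos.trans_le (one_le_secondEigenvalue hG hd hd0)) (by positivity)
  have hup : ∀ s > secondEigenvalue G / d, ∃ C : ℝ, 0 < C ∧ ∀ᶠ t : ℕ in atTop, ∀ u v,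
      |(transition G ^ t) u v - stationary G v| ≤ C * s ^ t := by
    intro s hs
    refine ⟨1, one_pos, (eventually_abs_transition_sub_le hG hd hd0 hs).mono fun t ht u v => ?_⟩
    rw [stationary_eq hd hd0, one_mul]
    exact ht u v
  have hlo : ∃ c : ℝ, 0 < c ∧ ∃ᶠ t : ℕ in atTop, ∃ u v,
      c * (secondEigenvalue G / d) ^ t ≤ |(transition G ^ t) u v - stationary G v| := by
    refine ⟨1 / Fintype.card V, by positivity, Frequently.of_forall fun t => ?_⟩
    obtain ⟨u, v, h⟩ := exists_transition_entry_ge hG hd hd0 t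
    refine ⟨u, v, ?_⟩
    rwa [stationary_eq hd hd0, one_div_mul_eq_div]
  exact ⟨pointwiseRate_eq hr hup hlo, chiSqRate_eq hr (stationary_eq hd hd0) hup hlo⟩

theorem nbMixingRate_eq (hG : G.Connected) (hd : G.IsRegularOfDegree d) (hd3 : 3 ≤ d) :
    nbMixingRate G = nbRoot ((d : ℝ) - 1) (secondEigenvalue G) / ((d : ℝ) - 1) ∧
      nbChiMixingRate G = nbRoot ((d : ℝ) - 1) (secondEigenvalue G) / ((d : ℝ) - 1) := by
  have : Nonempty V := hG.nonempty
  have hd0 : 0 < d := by omega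
  have hN : 0 < Fintype.card G.Dart := by
    rw [card_dart_eq hd]; exact Nat.mul_pos Fintype.card_pos hd0
  have : Nonempty G.Dart := Fintype.card_pos_iff.1 hN
  have hNpos : (0 : ℝ) < Fintype.card G.Dart := by exact_mod_cast hN
  have hq1 := one_lt_natCast_sub_one hd3
  set r := nbRoot ((d : ℝ) - 1) (secondEigenvalue G) / ((d : ℝ) - 1) with hr_def
  have hr : 0 < r := div_pos (one_pos.trans_le (one_le_nbRoot hq1.le)) (by linarith)
  have hup : ∀ s > r, ∃ C : ℝ, 0 < C ∧ ∀ᶠ t : ℕ in atTop, ∀ u v,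
      |nbVertexTransition G t u v - stationary G v| ≤ C * s ^ t := by
    intro s hs
    refine ⟨(Fintype.card G.Dart : ℝ) ^ 2, by positivity,
      (eventually_abs_nbTransition_sub_le hG hd hd3 hs).mono fun t ht u v => ?_⟩
    rw [stationary_eq hd hd0]
    exact abs_nbVertexTransition_sub_le hd hd0 ht u v
  have hup' : ∀ s > r, ∃ C : ℝ, 0 < C ∧ ∀ᶠ t : ℕ in atTop, ∀ e f,
      |(nbTransition G ^ t) e f - nbStationary G f| ≤ C * s ^ t := by
    intro s hs
    refine ⟨1, one_pos, (eventually_abs_nbTransition_sub_le hG hd hd3 hs).mono fun t ht e f => ?_⟩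
    rw [nbStationary_eq hd, one_mul]
    exact ht e f
  obtain ⟨c, hc, hfreq⟩ := frequently_nbVertexTransition_entry_ge hG hd hd3
  have hlo' : ∃ᶠ t : ℕ in atTop, ∃ e f, c / (Fintype.card G.Dart : ℝ) ^ 2 * r ^ t ≤
      |(nbTransition G ^ t) e f - nbStationary G f| := by
    refine hfreq.mono ?_
    rintro t ⟨u, v, h⟩
    -- The largest dart error serves as `ε` in the comparison with the vertex walk.
    obtain ⟨⟨e, f⟩, hmax⟩ := Finite.exists_max fun p : G.Dart × G.Dart =>
      |(nbTransition G ^ t) p.1 p.2 - 1 / (Fintype.card G.Dart : ℝ)|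
    refine ⟨e, f, ?_⟩
    rw [nbStationary_eq hd, div_mul_eq_mul_div, div_le_iff₀ (by positivity), mul_comm _ (_ ^ 2)]
    exact h.trans (abs_nbVertexTransition_sub_le hd hd0 (fun e f => hmax (e, f)) u v)
  refine ⟨pointwiseRate_eq hr hup ⟨c, hc, ?_⟩,
    chiSqRate_eq hr (nbStationary_eq hd) hup' ⟨_, by positivity, hlo'⟩⟩
  simpa only [stationary_eq hd hd0] using hfreq

end Regular

/-! ### A lower bound for the second eigenvalue -/

section AlonBoppana

variable {V : Type*} [Fintype V] [DecidableEq V] {G : SimpleGraph V} [DecidableRel G.Adj] {d : ℕ}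

theorem nbCount_nonneg (k : ℕ) (u v : V) : 0 ≤ nbCount ℝ G k u v := by
  have hS : ∀ w e, 0 ≤ startMat G ℝ w e := by
    intro w e; simp only [startMat]; split_ifs <;> simp
  have hB : ∀ k e f, 0 ≤ (nbMat G ℝ ^ k) e f := by
    intro k
    induction k with
    | zero => intro e f; rw [pow_zero, Matrix.one_apply]; split_ifs <;> simp
    | succ k ih =>
      intro e f
      rw [pow_succ, Matrix.mul_apply]
      refine Finset.sum_nonneg fun g _ => mul_nonneg (ih e g) ?_
      simp only [nbMat]; split_ifs <;> simp
  simp only [nbCount, Matrix.mul_apply, Matrix.transpose_apply]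
  exact Finset.sum_nonneg fun f _ => mul_nonneg
    (Finset.sum_nonneg fun e _ => mul_nonneg (hS u e) (hB k e f)) (hS v f)

/-- A vector `x` with `A x ≥ r x` certifies that `secondEigenvalue` is almost `r`, unless the mass
of `x` is spread over many vertices. -/
theorem sub_secondEigenvalue_mul_le (hG : G.Connected) (hd : G.IsRegularOfDegree d) {x : V → ℝ}
    {r : ℝ} (hx : ∀ v, 0 ≤ x v) (h : ∀ v, r * x v ≤ (G.adjMatrix ℝ).mulVec x v) :
    (r - secondEigenvalue G) * (x ⬝ᵥ x) ≤ d * (∑ v, x v) ^ 2 / Fintype.card V := by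
  have : Nonempty V := hG.nonempty
  have hn : (0 : ℝ) < Fintype.card V := by exact_mod_cast Fintype.card_pos
  set n : ℝ := (Fintype.card V : ℝ)
  set w := ∑ v, x v with hw
  have h1 : r * (x ⬝ᵥ x) ≤ x ⬝ᵥ (G.adjMatrix ℝ).mulVec x := by
    simp only [dotProduct, Finset.mul_sum]
    refine Finset.sum_le_sum fun v _ => ?_
    have := mul_le_mul_of_nonneg_left (h v) (hx v)
    linarith
  have hone : (1 : V → ℝ) ⬝ᵥ 1 = n := by simp [n]
  have hxo : x ⬝ᵥ (1 : V → ℝ) = w := dotProduct_one x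
  have hox : (1 : V → ℝ) ⬝ᵥ x = w := by rw [dotProduct_comm, hxo]
  -- Removing the mean lowers the quadratic form by exactly `d * w ^ 2 / n`, the right-hand side of
  -- the claim.
  have hsum : ∑ v, (x - (w / n) • (1 : V → ℝ)) v = 0 := by
    simp only [Pi.sub_apply, Pi.smul_apply, Pi.one_apply, smul_eq_mul, mul_one,
      Finset.sum_sub_distrib, Finset.sum_const, Finset.card_univ, nsmul_eq_mul]
    rw [← hw, mul_div_cancel₀ _ hn.ne', sub_self]
  have h2 := (le_abs_self _).trans (abs_dotProduct_adjMatrix_mulVec_le hG hd hsum)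
  have hA1 : (1 : V → ℝ) ⬝ᵥ (G.adjMatrix ℝ).mulVec x = d * w := by
    rw [dotProduct_adjMatrix_mulVec_comm, adjMatrix_mulVec_one ℝ hd, smul_dotProduct, hox,
      smul_eq_mul]
  simp only [Matrix.mulVec_sub, Matrix.mulVec_smul, adjMatrix_mulVec_one ℝ hd, sub_dotProduct,
    dotProduct_sub, smul_dotProduct, dotProduct_smul, hA1, hone, hxo, hox, smul_eq_mul] at h2
  have h3 : w - w / n * n = 0 := by rw [div_mul_cancel₀ _ hn.ne', sub_self]
  have h4 : w / n * w = w ^ 2 / n := by ring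
  have h5 : 0 ≤ secondEigenvalue G * (w ^ 2 / n) :=
    mul_nonneg secondEigenvalue_nonneg (by positivity)
  have h6 : w / n * (d * w) = d * (w ^ 2 / n) := by ring
  rw [h3, h4, h6] at h2
  have h9 : (d : ℝ) * w ^ 2 / n = d * (w ^ 2 / n) := mul_div_assoc _ _ _
  rw [h9]
  nlinarith

/-- The coefficients of the test vector in the Alon–Boppana bound: an eigenvector of a path,
scaled by powers of `s`. -/
def pathCoeff (θ s : ℝ) (i : ℕ) : ℝ := Real.sin ((i + 1) * θ) / s ^ i

theorem pathCoeff_zero (θ s : ℝ) : pathCoeff θ s 0 = Real.sin θ := by simp [pathCoeff]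

/-- The boundary case of `pathCoeff_rec`: the missing preceding term carries `sin 0 = 0`. -/
theorem pathCoeff_rec_zero {θ s : ℝ} (hs : s ≠ 0) :
    2 * s * Real.cos θ * pathCoeff θ s 0 = s * s * pathCoeff θ s 1 := by
  have h2 : Real.sin (2 * θ) = 2 * Real.sin θ * Real.cos θ := Real.sin_two_mul θ
  simp only [pathCoeff]
  norm_num
  rw [h2]
  field_simp

theorem pathCoeff_rec {θ s : ℝ} (hs : s ≠ 0) (k : ℕ) :
    2 * s * Real.cos θ * pathCoeff θ s (k + 1) =
      pathCoeff θ s k + s * s * pathCoeff θ s (k + 2) := by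
  have h1 : Real.sin (θ * (k + 1 : ℝ)) + Real.sin (θ * (k + 3 : ℝ)) =
      2 * Real.sin (θ * (k + 2 : ℝ)) * Real.cos θ := by
    have e1 : θ * (k + 1 : ℝ) = θ * (k + 2 : ℝ) - θ := by ring
    have e2 : θ * (k + 3 : ℝ) = θ * (k + 2 : ℝ) + θ := by ring
    rw [e1, e2, Real.sin_sub, Real.sin_add]; ring
  have e3 : ((k + 1 : ℕ) : ℝ) + 1 = k + 2 := by push_cast; ring
  have e4 : ((k + 2 : ℕ) : ℝ) + 1 = k + 3 := by push_cast; ring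
  simp only [pathCoeff, e3, e4, pow_succ]
  field_simp
  rw [mul_comm _ θ]
  linarith

theorem pathCoeff_nonneg {θ s : ℝ} (hs : 0 ≤ s) (hθ : 0 ≤ θ) {i L : ℕ}
    (hL : ((L : ℝ) + 1) * θ = Real.pi) (hi : i ≤ L) : 0 ≤ pathCoeff θ s i := by
  refine div_nonneg (Real.sin_nonneg_of_nonneg_of_le_pi (by positivity) ?_) (by positivity)
  rw [← hL]
  have : (i : ℝ) ≤ L := by exact_mod_cast hi
  gcongr

theorem pathCoeff_le_one {θ s : ℝ} (hs : 1 ≤ s) (i : ℕ) : pathCoeff θ s i ≤ 1 :=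
  div_le_one_of_le₀ ((Real.sin_le_one _).trans (one_le_pow₀ hs)) (by positivity)

theorem pathCoeff_eq_zero {θ s : ℝ} {L : ℕ} (hL : ((L : ℝ) + 1) * θ = Real.pi) :
    pathCoeff θ s L = 0 := by
  rw [pathCoeff, hL, Real.sin_pi, zero_div]

/-- The two sides are `d - 1` and `d` times the adjacency matrix. -/
theorem nbCount_one_le (hd : G.IsRegularOfDegree d) (u v : V) :
    nbCount ℝ G 1 u v ≤ (G.adjMatrix ℝ * nbCount ℝ G 0) u v := by
  rw [nbCount_zero ℝ hd, nbCount_one ℝ hd, Matrix.mul_smul, Matrix.mul_one]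
  simp only [Matrix.smul_apply, smul_eq_mul, SimpleGraph.adjMatrix_apply]
  split_ifs <;> linarith

theorem adjMatrix_mul_nbCount_succ (hd : G.IsRegularOfDegree d) (k : ℕ) (u v : V) :
    (G.adjMatrix ℝ * nbCount ℝ G (k + 1)) u v =
      nbCount ℝ G (k + 2) u v + ((d : ℝ) - 1) * nbCount ℝ G k u v := by
  rw [nbCount_add_two ℝ hd, Matrix.sub_apply, Matrix.smul_apply, smul_eq_mul, sub_add_cancel]

/-- The column of `v` of a combination of the matrices `nbCount`. -/
def testVector (G : SimpleGraph V) [DecidableRel G.Adj] (θ s : ℝ) (L : ℕ) (v u : V) : ℝ :=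
  ∑ i ∈ Finset.range L, pathCoeff θ s i * nbCount ℝ G i u v

theorem adjMatrix_mulVec_testVector (θ s : ℝ) (L : ℕ) (v u : V) :
    (G.adjMatrix ℝ).mulVec (testVector G θ s L v) u =
      ∑ i ∈ Finset.range L, pathCoeff θ s i * (G.adjMatrix ℝ * nbCount ℝ G i) u v := by
  simp only [Matrix.mulVec, dotProduct, testVector, Finset.mul_sum, Matrix.mul_apply]
  rw [Finset.sum_comm]
  exact Finset.sum_congr rfl fun i _ => Finset.sum_congr rfl fun w _ => by ring

/-- Multiplying by the adjacency matrix sends `nbCount i` to its neighbours `i + 1` and, weighted by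
`s * s`, `i - 1`. Regrouping by `pathCoeff_rec` returns the factor `2 s cos θ` up to boundary terms
at the top index; the only inequality enters at `i = 0`. -/
theorem testVector_partial_le (hd : G.IsRegularOfDegree d) {θ s : ℝ} (hs : 0 < s)
    (hss : s * s = (d : ℝ) - 1) (hsin : 0 ≤ Real.sin θ) (k : ℕ) (v u : V) :
    2 * s * Real.cos θ * testVector G θ s (k + 1) v u +
      (pathCoeff θ s k * nbCount ℝ G (k + 1) u v -
        s * s * pathCoeff θ s (k + 1) * nbCount ℝ G k u v) ≤
      (G.adjMatrix ℝ).mulVec (testVector G θ s (k + 1) v) u := by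
  rw [adjMatrix_mulVec_testVector]
  induction k with
  | zero =>
    have h0 : 0 ≤ pathCoeff θ s 0 := by rwa [pathCoeff_zero]
    have h1 := mul_le_mul_of_nonneg_left (nbCount_one_le hd u v) h0
    simp only [testVector, zero_add, Finset.sum_range_one]
    rw [← pathCoeff_rec_zero hs.ne']
    linarith
  | succ k ih =>
    rw [Finset.sum_range_succ, adjMatrix_mul_nbCount_succ hd, testVector,
      Finset.sum_range_succ _ (k + 1), ← testVector, mul_add,
      ← mul_assoc (2 * s * Real.cos θ) (pathCoeff θ s (k + 1)), pathCoeff_rec hs.ne', ← hss]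
    linarith

theorem sum_nbCount_col (hd : G.IsRegularOfDegree d) (k : ℕ) (v : V) :
    ∑ u, nbCount ℝ G k u v = d * ((d : ℝ) - 1) ^ k := by
  simpa [Matrix.vecMul, dotProduct] using congrFun (vecMul_one_nbCount (G := G) ℝ hd k) v

theorem sum_testVector_le (hd : G.IsRegularOfDegree d) (hd3 : 3 ≤ d) {θ s : ℝ} (hs : 1 ≤ s)
    (L : ℕ) (v : V) : ∑ u, testVector G θ s L v u ≤ L * (d : ℝ) ^ (L + 1) := by
  have hq1 := one_lt_natCast_sub_one hd3
  have hd1 : (1 : ℝ) ≤ d := by linarith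
  simp only [testVector]
  rw [Finset.sum_comm]
  refine (Finset.sum_le_card_nsmul _ _ ((d : ℝ) ^ (L + 1)) fun i hi => ?_).trans_eq ?_
  · rw [← Finset.mul_sum, sum_nbCount_col hd]
    have hi' : i ≤ L := (Finset.mem_range.1 hi).le
    have hq0 : 0 ≤ (d : ℝ) - 1 := by linarith
    have hle : ((d : ℝ) - 1) ^ i ≤ (d : ℝ) ^ i := pow_le_pow_left₀ hq0 (by linarith) i
    calc pathCoeff θ s i * (d * ((d : ℝ) - 1) ^ i) ≤ 1 * (d * (d : ℝ) ^ i) :=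
          mul_le_mul (pathCoeff_le_one hs i) (mul_le_mul_of_nonneg_left hle (by positivity))
            (by positivity) zero_le_one
      _ = (d : ℝ) ^ (i + 1) := by ring
      _ ≤ (d : ℝ) ^ (L + 1) := pow_le_pow_right₀ hd1 (by omega)
  · rw [Finset.card_range, nsmul_eq_mul]

/-- The quantitative Alon–Boppana bound. -/
theorem alonBoppana (hG : G.Connected) (hd : G.IsRegularOfDegree d) (hd3 : 3 ≤ d) {L : ℕ}
    (hL0 : 0 < L) {θ : ℝ} (hθ : 0 ≤ θ) (hL : ((L : ℝ) + 1) * θ = Real.pi) :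
    (2 * Real.sqrt ((d : ℝ) - 1) * Real.cos θ - secondEigenvalue G) *
      (Real.sin θ ^ 2 * Fintype.card V) ≤ (L : ℝ) ^ 2 * (d : ℝ) ^ (2 * L + 1) := by
  obtain ⟨v⟩ := hG.nonempty
  have : Nonempty V := ⟨v⟩
  have hn : (0 : ℝ) < Fintype.card V := by exact_mod_cast Fintype.card_pos
  have hq1 := one_lt_natCast_sub_one hd3
  have hd0 : (0 : ℝ) < d := by linarith
  have hs1 : 1 ≤ Real.sqrt ((d : ℝ) - 1) := Real.one_le_sqrt.2 hq1.le
  have hss : Real.sqrt ((d : ℝ) - 1) * Real.sqrt ((d : ℝ) - 1) = (d : ℝ) - 1 :=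
    Real.mul_self_sqrt (by linarith)
  set s := Real.sqrt ((d : ℝ) - 1) with hs
  have hs0 : 0 < s := by linarith
  have ha : ∀ i ≤ L, 0 ≤ pathCoeff θ s i := fun i hi => pathCoeff_nonneg hs0.le hθ hL hi
  have hsin : 0 ≤ Real.sin θ := pathCoeff_zero θ s ▸ ha 0 (Nat.zero_le L)
  have hterm : ∀ u, ∀ i ∈ Finset.range L, 0 ≤ pathCoeff θ s i * nbCount ℝ G i u v :=
    fun u i hi => mul_nonneg (ha i (Finset.mem_range.1 hi).le) (nbCount_nonneg i u v)
  have hx0 : ∀ u, 0 ≤ testVector G θ s L v u := fun u => Finset.sum_nonneg (hterm u)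
  have hxA : ∀ u, 2 * s * Real.cos θ * testVector G θ s L v u ≤
      (G.adjMatrix ℝ).mulVec (testVector G θ s L v) u := by
    intro u
    obtain ⟨K, rfl⟩ := Nat.exists_eq_succ_of_ne_zero hL0.ne'
    have h2 := testVector_partial_le hd hs0 hss hsin K v u
    have h3 := mul_nonneg (ha K (Nat.le_succ K)) (nbCount_nonneg (G := G) (K + 1) u v)
    -- The negative boundary term vanishes because `(L + 1) * θ = π`; the remaining one is
    -- nonnegative.
    rw [← Nat.succ_eq_add_one K, pathCoeff_eq_zero hL, mul_zero, zero_mul, sub_zero] at h2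
    exact (le_add_of_nonneg_right h3).trans h2
  have hkey := sub_secondEigenvalue_mul_le hG hd hx0 hxA
  have hwle := sum_testVector_le (θ := θ) hd hd3 hs1 L v
  have hw0 : 0 ≤ ∑ u, testVector G θ s L v u := Finset.sum_nonneg fun u _ => hx0 u
  have hxv : Real.sin θ * d ≤ testVector G θ s L v v := by
    have h1 := Finset.single_le_sum (hterm v) (Finset.mem_range.2 hL0)
    rw [pathCoeff_zero, nbCount_zero ℝ hd] at h1
    simpa [testVector] using h1
  have hxx : (Real.sin θ * d) ^ 2 ≤ testVector G θ s L v ⬝ᵥ testVector G θ s L v := by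
    refine le_trans ?_ (Finset.single_le_sum
      (f := fun u => testVector G θ s L v u * testVector G θ s L v u)
      (fun u _ => mul_self_nonneg _) (Finset.mem_univ v))
    rw [sq]
    exact mul_self_le_mul_self (by positivity) hxv
  rcases le_or_gt (2 * s * Real.cos θ - secondEigenvalue G) 0 with hneg | hpos
  · exact (mul_nonpos_of_nonpos_of_nonneg hneg (by positivity)).trans (by positivity)
  have h1 : (2 * s * Real.cos θ - secondEigenvalue G) * (Real.sin θ * d) ^ 2 ≤
      d * (L * (d : ℝ) ^ (L + 1)) ^ 2 / Fintype.card V := by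
    refine (mul_le_mul_of_nonneg_left hxx hpos.le).trans (hkey.trans ?_)
    exact div_le_div_of_nonneg_right
      (mul_le_mul_of_nonneg_left (pow_le_pow_left₀ hw0 hwle 2) hd0.le) hn.le
  rw [le_div_iff₀ hn] at h1
  refine le_of_mul_le_mul_right ?_ (pow_pos hd0 2)
  calc _ = (2 * s * Real.cos θ - secondEigenvalue G) * (Real.sin θ * d) ^ 2 *
        Fintype.card V := by ring
    _ ≤ _ := h1
    _ = _ := by ring

end AlonBoppana

/-- The path length `L` depends on `κ` only. With `L` fixed, `d ^ (2L+1) = n ^ (ε (2L+1))` is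
eventually at most `n ^ (1/2)`, so the error in `alonBoppana` is `O(n ^ (-1/2))`. -/
theorem eventually_two_sqrt_mul_le {V : ℕ → Type*} [∀ i, Fintype (V i)] [∀ i, DecidableEq (V i)]
    {G : ∀ i, SimpleGraph (V i)} [∀ i, DecidableRel (G i).Adj] {d : ℕ → ℕ} {ε : ℕ → ℝ}
    (hd3 : ∀ i, 3 ≤ d i) (hG : ∀ i, (G i).Connected) (hd : ∀ i, (G i).IsRegularOfDegree (d i))
    (hn : Tendsto (fun i => Fintype.card (V i)) atTop atTop) (hε : Tendsto ε atTop (𝓝 0))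
    (hdn : ∀ i, (d i : ℝ) = (Fintype.card (V i) : ℝ) ^ ε i) {κ : ℝ} (hκ : 0 < κ) :
    ∀ᶠ i in atTop, 2 * Real.sqrt ((d i : ℝ) - 1) * (1 - κ) ≤ secondEigenvalue (G i) := by
  have hcos : Tendsto (fun L : ℕ => Real.cos (Real.pi / ((L : ℝ) + 1))) atTop (𝓝 1) := by
    have h1 : Tendsto (fun L : ℕ => Real.pi / ((L : ℝ) + 1)) atTop (𝓝 0) :=
      tendsto_const_nhds.div_atTop (tendsto_atTop_add_const_right _ _ tendsto_natCast_atTop_atTop)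
    have h2 := (Real.continuous_cos.tendsto 0).comp h1
    rwa [Real.cos_zero] at h2
  obtain ⟨L, hL1, hL⟩ := ((hcos.eventually_const_lt (show 1 - κ / 2 < 1 by linarith)).and
    (eventually_gt_atTop 0)).exists
  set θ := Real.pi / ((L : ℝ) + 1) with hθ
  have hsin : 0 < Real.sin θ := by
    refine Real.sin_pos_of_pos_of_lt_pi (by positivity) ?_
    rw [hθ, div_lt_iff₀ (by positivity)]
    have : (0 : ℝ) < L := by exact_mod_cast hL
    nlinarith [Real.pi_pos]
  have hnR : Tendsto (fun i => (Fintype.card (V i) : ℝ)) atTop atTop :=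
    tendsto_natCast_atTop_atTop.comp hn
  have hsmall : Tendsto (fun i => (L : ℝ) ^ 2 / Real.sin θ ^ 2 *
      (Fintype.card (V i) : ℝ) ^ (-(1 / 2 : ℝ))) atTop (𝓝 0) := by
    have h1 := ((tendsto_rpow_neg_atTop (show (0 : ℝ) < 1 / 2 by norm_num)).comp hnR).const_mul
      ((L : ℝ) ^ 2 / Real.sin θ ^ 2)
    simpa using h1
  have hε' : Tendsto (fun i => ε i * (2 * L + 1 : ℕ)) atTop (𝓝 0) := by
    simpa using hε.mul_const ((2 * L + 1 : ℕ) : ℝ)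
  filter_upwards [hsmall.eventually_lt_const (show (0 : ℝ) < κ / 2 by linarith),
    hε'.eventually_lt_const (show (0 : ℝ) < 1 / 2 by norm_num),
    hnR.eventually_ge_atTop 1] with i h1 h2 h3
  have hs1 : 1 ≤ Real.sqrt ((d i : ℝ) - 1) :=
    Real.one_le_sqrt.2 (one_lt_natCast_sub_one (hd3 i)).le
  have hn0 : (0 : ℝ) < Fintype.card (V i) := by linarith
  have hab := alonBoppana (hG i) (hd i) (hd3 i) hL (θ := θ) (by positivity)
    (by rw [hθ]; field_simp)
  have hpow : (d i : ℝ) ^ (2 * L + 1) ≤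
      (Fintype.card (V i) : ℝ) ^ (-(1 / 2 : ℝ)) * Fintype.card (V i) := by
    rw [hdn, ← Real.rpow_mul_natCast hn0.le]
    calc _ ≤ (Fintype.card (V i) : ℝ) ^ (-(1 / 2 : ℝ) + 1) :=
          Real.rpow_le_rpow_of_exponent_le h3 (by linarith)
      _ = _ := by rw [Real.rpow_add_one hn0.ne']
  have h4 : 2 * Real.sqrt ((d i : ℝ) - 1) * Real.cos θ - secondEigenvalue (G i) ≤ κ / 2 := by
    refine le_trans ?_ h1.le
    rw [div_mul_eq_mul_div, le_div_iff₀ (by positivity)]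
    refine le_of_mul_le_mul_right ?_ hn0
    calc _ = _ := by rw [mul_assoc]
      _ ≤ _ := hab
      _ ≤ _ := by rw [mul_assoc]; gcongr
  have h5 : 2 * Real.sqrt ((d i : ℝ) - 1) * (1 - κ / 2) ≤
      2 * Real.sqrt ((d i : ℝ) - 1) * Real.cos θ := by gcongr
  -- Half of `κ` is lost to the cosine; the additive error `κ / 2` fits into the other half since
  -- `√(d - 1) ≥ 1`.
  nlinarith

/-! ### The ratio of the rates as a function of `q` and `l`. -/

theorem nbRoot_of_lt {q l : ℝ} (hl : 0 ≤ l) (hq : 0 ≤ q) (h : l < 2 * Real.sqrt q) :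
    nbRoot q l = Real.sqrt q := by
  have hs := Real.sq_sqrt hq
  rw [nbRoot, Real.sqrt_eq_zero_of_nonpos (show l ^ 2 - 4 * q ≤ 0 by nlinarith), add_zero]
  exact max_eq_left (by linarith)

theorem nbRoot_of_le {q l : ℝ} (h : 2 * Real.sqrt q ≤ l) :
    nbRoot q l = (l + Real.sqrt (l ^ 2 - 4 * q)) / 2 :=
  max_eq_right ((le_div_iff₀' two_pos).2 (h.trans (le_add_of_nonneg_right (Real.sqrt_nonneg _))))

theorem ratio_bounds_of_le {q l : ℝ} (hq : 1 < q) (hl : l ≤ q + 1) (h : 2 * Real.sqrt q ≤ l) :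
    (q + 1) / (2 * q) ≤ nbRoot q l / q / (l / (q + 1)) ∧
      nbRoot q l / q / (l / (q + 1)) ≤ 1 := by
  have hq0 : 0 < q := by linarith
  have hl0 : 0 < l := by linarith [Real.sqrt_pos.2 hq0]
  rw [nbRoot_of_le h]
  have hs := Real.sqrt_nonneg (l ^ 2 - 4 * q)
  -- Equality holds at `l = q + 1`, where `l ^ 2 - 4 * q = (q - 1) ^ 2`. This is the upper bound;
  -- the lower one just drops the square root.
  have hle : Real.sqrt (l ^ 2 - 4 * q) ≤ l * (q - 1) / (q + 1) := by
    refine Real.sqrt_le_iff.2 ⟨div_nonneg (mul_nonneg hl0.le (by linarith)) (by linarith), ?_⟩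
    rw [div_pow, le_div_iff₀ (by positivity)]
    have : l ^ 2 ≤ (q + 1) ^ 2 := by gcongr
    nlinarith
  rw [le_div_iff₀ (by linarith)] at hle
  set s := Real.sqrt (l ^ 2 - 4 * q)
  have heq : (l + s) / 2 / q / (l / (q + 1)) = (l + s) * (q + 1) / (2 * q * l) := by field_simp
  rw [heq]
  constructor
  · rw [div_le_div_iff₀ (by positivity) (by positivity)]
    have : 0 ≤ s * (q + 1) * (2 * q) := by positivity
    nlinarith
  · rw [div_le_one (by positivity)]
    nlinarith

theorem tendsto_ratio_of_eventually {q l : ℕ → ℝ} (hq : ∀ i, 1 < q i)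
    (hl0 : ∀ i, 0 < l i) (hl : ∀ i, l i < 2 * Real.sqrt (q i))
    (h : ∀ κ > 0, ∀ᶠ i in atTop, 2 * Real.sqrt (q i) * (1 - κ) ≤ l i) :
    Tendsto (fun i => nbRoot (q i) (l i) / q i / (l i / (q i + 1)) - (q i + 1) / (2 * q i))
      atTop (𝓝 0) := by
  have heq : ∀ i, nbRoot (q i) (l i) / q i / (l i / (q i + 1)) - (q i + 1) / (2 * q i) =
      (q i + 1) / (2 * q i) * ((2 * Real.sqrt (q i) - l i) / l i) := by
    intro i
    have := hq i
    have h1 := (hl0 i).ne'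
    have h2 : q i ≠ 0 := by linarith
    have h3 : q i + 1 ≠ 0 := by linarith
    rw [nbRoot_of_lt (hl0 i).le (by linarith) (hl i)]
    field_simp
  simp only [heq]
  rw [Metric.tendsto_nhds]
  intro δ hδ
  -- The bound `κ ≤ 1/2` gives `l ≥ √q`, so the relative defect `(2√q - l) / l` is at most `2κ ≤ δ /
  -- 2`.
  set κ := min (1 / 2) (δ / 4) with hκ
  have hκ0 : 0 < κ := lt_min (by norm_num) (by linarith)
  have hκ1 : κ ≤ 1 / 2 := min_le_left _ _
  have hκ2 : κ ≤ δ / 4 := min_le_right _ _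
  filter_upwards [h κ hκ0] with i hi
  have h1 := hq i
  have h2 := hl0 i
  have h3 := hl i
  have hs : 0 < Real.sqrt (q i) := Real.sqrt_pos.2 (by linarith)
  have hA : (q i + 1) / (2 * q i) ≤ 1 := by rw [div_le_one (by linarith)]; linarith
  have hA0 : 0 ≤ (q i + 1) / (2 * q i) := by positivity
  have hB0 : 0 ≤ (2 * Real.sqrt (q i) - l i) / l i := div_nonneg (by linarith) h2.le
  have hB : (2 * Real.sqrt (q i) - l i) / l i ≤ δ / 2 := by
    rw [div_le_iff₀ h2]
    have h4 : Real.sqrt (q i) ≤ l i := by nlinarith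
    have h5 : 2 * Real.sqrt (q i) * κ ≤ 2 * Real.sqrt (q i) * (δ / 4) := by gcongr
    have h6 : Real.sqrt (q i) * (δ / 2) ≤ l i * (δ / 2) := by gcongr
    nlinarith
  rw [Real.dist_eq, sub_zero, abs_of_nonneg (mul_nonneg hA0 hB0)]
  calc _ ≤ 1 * (δ / 2) := mul_le_mul hA hB hB0 zero_le_one
    _ < δ := by linarith

end NBWalk

end

theorem mainTheorem3 :
    (∀ (V : Type*) [Fintype V] [DecidableEq V] (G : SimpleGraph V) [DecidableRel G.Adj] (d : ℕ),
      3 ≤ d → G.Connected → ¬ G.IsBipartite → G.IsRegularOfDegree d →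
      2 * Real.sqrt ((d : ℝ) - 1) ≤ NBWalk.secondEigenvalue G →
        ((d : ℝ) / (2 * ((d : ℝ) - 1)) ≤ NBWalk.nbMixingRate G / NBWalk.mixingRate G ∧
          NBWalk.nbMixingRate G / NBWalk.mixingRate G ≤ 1) ∧
        ((d : ℝ) / (2 * ((d : ℝ) - 1)) ≤ NBWalk.nbChiMixingRate G / NBWalk.chiMixingRate G ∧
          NBWalk.nbChiMixingRate G / NBWalk.chiMixingRate G ≤ 1)) ∧
    (∀ (V : ℕ → Type*) [∀ i, Fintype (V i)] [∀ i, DecidableEq (V i)]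
      (G : ∀ i, SimpleGraph (V i)) [∀ i, DecidableRel (G i).Adj] (d : ℕ → ℕ) (ε : ℕ → ℝ),
      (∀ i, 3 ≤ d i) → (∀ i, (G i).Connected) → (∀ i, ¬ (G i).IsBipartite) →
      (∀ i, (G i).IsRegularOfDegree (d i)) →
      (∀ i, NBWalk.secondEigenvalue (G i) < 2 * Real.sqrt ((d i : ℝ) - 1)) →
      Tendsto (fun i => Fintype.card (V i)) atTop atTop →
      Tendsto ε atTop (𝓝 0) →
      (∀ i, (d i : ℝ) = (Fintype.card (V i) : ℝ) ^ ε i) →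
        Tendsto (fun i => NBWalk.nbMixingRate (G i) / NBWalk.mixingRate (G i) -
          (d i : ℝ) / (2 * ((d i : ℝ) - 1))) atTop (𝓝 0) ∧
        Tendsto (fun i => NBWalk.nbChiMixingRate (G i) / NBWalk.chiMixingRate (G i) -
          (d i : ℝ) / (2 * ((d i : ℝ) - 1))) atTop (𝓝 0)) := by
  constructor
  · intro V _ _ G _ d hd3 hG _ hd hl
    have hd0 : 0 < d := by omega
    have : Nonempty V := hG.nonempty
    have hV : 1 < Fintype.card V := by have := NBWalk.lt_card_of_regular hd; omega
    obtain ⟨h1, h2⟩ := NBWalk.mixingRate_eq hG hd hd0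
    obtain ⟨h3, h4⟩ := NBWalk.nbMixingRate_eq hG hd hd3
    have h := NBWalk.ratio_bounds_of_le (NBWalk.one_lt_natCast_sub_one hd3)
      (by rw [sub_add_cancel]; exact NBWalk.secondEigenvalue_le hG hd hV) hl
    rw [sub_add_cancel] at h
    rw [h1, h2, h3, h4]
    exact ⟨h, h⟩
  · intro V _ _ G _ d ε hd3 hG _ hd hl hn hε hdn
    have h := NBWalk.tendsto_ratio_of_eventually
      (fun i => NBWalk.one_lt_natCast_sub_one (hd3 i))
      (fun i => one_pos.trans_le
        (NBWalk.one_le_secondEigenvalue (hG i) (hd i) (three_pos.trans_le (hd3 i))))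
      hl fun κ hκ => NBWalk.eventually_two_sqrt_mul_le hd3 hG hd hn hε hdn hκ
    have hd0 : ∀ i, 0 < d i := fun i => three_pos.trans_le (hd3 i)
    simp only [sub_add_cancel] at h
    simp only [fun i => (NBWalk.mixingRate_eq (hG i) (hd i) (hd0 i)).1,
      fun i => (NBWalk.mixingRate_eq (hG i) (hd i) (hd0 i)).2,
      fun i => (NBWalk.nbMixingRate_eq (hG i) (hd i) (hd3 i)).1,
      fun i => (NBWalk.nbMixingRate_eq (hG i) (hd i) (hd3 i)).2]
    exact ⟨h, h⟩
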